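/- Let $\zeta$ be the Riemann zeta-function, $\chi(s)=2^s\pi^{s-1}\sin(\pi s/2)\Gamma(1-s)$, and let $Z(t)=\chi^{-1/2}(\tfrac12+it)\,\zeta(\tfrac12+it)$ ($t\in\mathbb R$) be Hardy's function, where $\chi^{-1/2}(\tfrac12+it)=\pi^{-it/2}\,\Gamma(\tfrac14+\tfrac{it}2)/|\Gamma(\tfrac14+\tfrac{it}2)|$ is the continuous branch equal to $1$ at $t=0$. For real $\alpha>0$ and $\beta$, let $E_\alpha^\beta$ be the class of even $C^\infty$ functions $f:\mathbb R\to\mathbb R$, not identically zero, for which there are constants $A,B,C>0$ such that $$|x^kf^{(q)}(x)|\le CA^kB^q\,k^{k\alpha}q^{q\beta}\qquad(x\in\mathbb R;\ k,q=0,1,2,\dots),$$ with $0^0=1$. For $f\in E_\alpha^\beta$ and $G>0$ put $$M_{Z,f}(t)=\int_{-\infty}^{\infty}Z(t+x)\,f\Bigl(\frac xG\Bigr)\,dx,\qquad \widehat f(x)=\int_{-\infty}^{\infty}f(u)e^{2\pi i x u}\,du .$$ **Lemma 1.** Let $f\in E_\alpha^\beta$, $\varepsilon>0$ and $c>0$.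 There is a constant $K>0$, depending only on $\alpha,\beta,f,\varepsilon,c$, such that for all real $T,G,V$ with $T>1$, $0<G<1$ and $cL\le V\le T^{1/3}$, where $L=(\log T)^{1/2+\varepsilon}$ and $P=\sqrt{T/(2\pi)}$, one has $$\int_{T-VL}^{T+VL}|M_{Z,f}(t)|\,e^{-(T-t)^2V^{-2}}\,dt\ \ge\ GV\Bigl\{\bigl|\widehat f\bigl(\tfrac{G}{2\pi}\log P\bigr)\bigr|-K\bigl(T^{-1/4}+V^2T^{-3/4}L^2\bigr)\Bigr\}.$$ -/

import Mathlib

open scoped ContDiff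

noncomputable section

/-- The factor in the functional equation `ζ(s) = χ(s) ζ(1 - s)`:
`χ(s) = 2 ^ s * π ^ (s - 1) * sin (π s / 2) * Γ(1 - s)`. -/
def zetaChi (s : ℂ) : ℂ :=
  2 ^ s * (Real.pi : ℂ) ^ (s - 1) * Complex.sin (Real.pi * s / 2) * Complex.Gamma (1 - s)

/-- The function `t ↦ χ(1/2 + it) ^ (-1/2)` on the real line, that is, the continuous branch which
equals `1` at `t = 0`:
`π ^ (-it/2) * Γ(1/4 + it/2) ^ (1/2) / Γ(1/4 - it/2) ^ (1/2) = exp (i θ(t))`, the phase of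
`Γ_ℝ(1/2 + it) = π ^ (-(1/2 + it)/2) * Γ((1/2 + it)/2)`. The next three facts characterize it. -/
def chiInvSqrt (t : ℝ) : ℂ :=
  Complex.Gammaℝ (1 / 2 + t * Complex.I) / (‖Complex.Gammaℝ (1 / 2 + t * Complex.I)‖ : ℝ)

theorem gammaR_half_ne_zero (t : ℝ) : Complex.Gammaℝ (1 / 2 + t * Complex.I) ≠ 0 :=
  Complex.Gammaℝ_ne_zero_of_re_pos (by simp)

theorem gammaR_conj (s : ℂ) :
    Complex.Gammaℝ (starRingEnd ℂ s) = starRingEnd ℂ (Complex.Gammaℝ s) := by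
  have h := Complex.cpow_conj (Real.pi : ℂ) (-s / 2) (by
    rw [Complex.arg_ofReal_of_nonneg Real.pi_pos.le]
    exact Real.pi_pos.ne)
  rw [Complex.conj_ofReal] at h
  rw [Complex.Gammaℝ_def, Complex.Gammaℝ_def, map_mul, ← Complex.Gamma_conj, ← h]
  simp [map_div₀, Complex.conj_ofNat]

theorem half_conj (t : ℝ) :
    starRingEnd ℂ (1 / 2 + t * Complex.I) = 1 - (1 / 2 + t * Complex.I) := by
  apply Complex.ext
  · simp; norm_num
  · simp

theorem zetaChi_half (t : ℝ) : zetaChi (1 / 2 + t * Complex.I) =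
    starRingEnd ℂ (Complex.Gammaℝ (1 / 2 + t * Complex.I)) /
      Complex.Gammaℝ (1 / 2 + t * Complex.I) := by
  set s : ℂ := 1 / 2 + t * Complex.I with hs
  have h := Complex.Gammaℝ_div_Gammaℝ_one_sub (s := 1 - s) (by
    intro n hn
    have := congrArg Complex.re hn
    simp [hs] at this
    have : (0 : ℝ) ≤ n := n.cast_nonneg
    linarith)
  rw [sub_sub_cancel] at h
  rw [← gammaR_conj, hs, half_conj, ← hs, h, Complex.Gammaℂ, zetaChi]
  have h1 : (Real.pi * (1 - s) / 2 : ℂ) = Real.pi / 2 - Real.pi * s / 2 := by ring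
  have h2 : (2 * Real.pi : ℂ) ^ (-(1 - s)) = 2 ^ (s - 1) * (Real.pi : ℂ) ^ (s - 1) := by
    have := Complex.mul_cpow_ofReal_nonneg (a := 2) (b := Real.pi) (by norm_num)
      Real.pi_pos.le (s - 1)
    rw [neg_sub]
    simpa using this
  have h3 : (2 : ℂ) ^ s = 2 * 2 ^ (s - 1) := by
    rw [Complex.cpow_sub _ _ (by norm_num), Complex.cpow_one]; field_simp
  rw [h1, Complex.cos_pi_div_two_sub, h2, h3]
  ring

theorem zetaChi_mul_chiInvSqrt_sq (t : ℝ) :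
    zetaChi (1 / 2 + t * Complex.I) * chiInvSqrt t ^ 2 = 1 := by
  rw [zetaChi_half, chiInvSqrt]
  have h := gammaR_half_ne_zero t
  generalize Complex.Gammaℝ (1 / 2 + t * Complex.I) = g at h
  have h' : ((‖g‖ : ℝ) : ℂ) ≠ 0 := by simpa using h
  have hc := Complex.conj_mul' g
  field_simp
  exact hc

theorem chiInvSqrt_zero : chiInvSqrt 0 = 1 := by
  have h : Complex.Gammaℝ (1 / 2 + (0 : ℝ) * Complex.I) =
      ((Real.pi ^ (-(1 / 4) : ℝ) * Real.Gamma (1 / 4) : ℝ) : ℂ) := by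
    rw [Complex.Gammaℝ_def, Complex.ofReal_mul, Complex.ofReal_cpow Real.pi_pos.le,
      ← Complex.Gamma_ofReal]
    congr 2 <;> push_cast <;> ring
  have hpos : 0 < Real.pi ^ (-(1 / 4) : ℝ) * Real.Gamma (1 / 4) :=
    mul_pos (Real.rpow_pos_of_pos Real.pi_pos _) (Real.Gamma_pos_of_pos (by norm_num))
  rw [chiInvSqrt, h, Complex.norm_real, Real.norm_of_nonneg hpos.le, div_self]
  exact_mod_cast hpos.ne'

theorem continuous_chiInvSqrt : Continuous chiInvSqrt := by
  have h : Continuous fun t : ℝ => Complex.Gammaℝ (1 / 2 + t * Complex.I) := by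
    have hinv : Continuous fun t : ℝ => (Complex.Gammaℝ (1 / 2 + t * Complex.I))⁻¹ :=
      Complex.differentiable_Gammaℝ_inv.continuous.comp (by fun_prop)
    have := hinv.inv₀ fun t => inv_ne_zero (gammaR_half_ne_zero t)
    exact this.congr fun t => inv_inv _
  exact h.div (Complex.continuous_ofReal.comp h.norm) fun t => by
    simpa using gammaR_half_ne_zero t

/-- Hardy's function `Z(t) = χ(1/2 + it) ^ (-1/2) * ζ(1/2 + it)`, which is real for real `t`
(see `coe_hardyZ`), as a function with values in `ℝ`. -/
def hardyZ (t : ℝ) : ℝ := (chiInvSqrt t * riemannZeta (1 / 2 + t * Complex.I)).re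

theorem coe_hardyZ (t : ℝ) :
    (hardyZ t : ℂ) = chiInvSqrt t * riemannZeta (1 / 2 + t * Complex.I) := by
  have hs0 : (1 / 2 + t * Complex.I : ℂ) ≠ 0 := fun h => by
    have := congrArg Complex.re h
    norm_num at this
  rw [hardyZ, ← Complex.conj_eq_iff_re, chiInvSqrt, div_mul_eq_mul_div,
    riemannZeta_def_of_ne_zero hs0, mul_div_cancel₀ _ (gammaR_half_ne_zero t), map_div₀,
    Complex.conj_ofReal]
  congr 1
  have hs1 : (1 - (1 / 2 + t * Complex.I) : ℂ) ≠ 0 := fun h => by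
    have := congrArg Complex.re h
    norm_num at this
  have hz := riemannZeta_conj (1 / 2 + t * Complex.I)
  rw [half_conj, riemannZeta_def_of_ne_zero hs0, riemannZeta_def_of_ne_zero hs1, map_div₀,
    ← gammaR_conj, half_conj, completedRiemannZeta_one_sub] at hz
  have hg : Complex.Gammaℝ (1 - (1 / 2 + t * Complex.I)) ≠ 0 :=
    Complex.Gammaℝ_ne_zero_of_re_pos (by norm_num)
  exact ((div_left_inj' hg).1 hz).symm

/-- The Gel'fand-Shilov class `S_α^β` of smooth real functions with
`|x ^ k * f^(q) x| ≤ C * A ^ k * B ^ q * k ^ (k α) * q ^ (q β)` for all `k, q ≥ 0` and real `x`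
(with `0 ^ 0 = 1`). -/
structure GelfandShilov (α β : ℝ) (f : ℝ → ℝ) : Prop where
  smooth : ContDiff ℝ ∞ f
  bound : ∃ A > 0, ∃ B > 0, ∃ C > 0, ∀ (k q : ℕ) (x : ℝ),
    |x ^ k * iteratedDeriv q f x| ≤
      C * A ^ k * B ^ q * (k : ℝ) ^ ((k : ℝ) * α) * (q : ℝ) ^ ((q : ℝ) * β)

/-- The class `E_α^β`: `α > 0`, and `f` is an even function in `S_α^β`, not identically zero. -/
structure EvenGelfandShilov (α β : ℝ) (f : ℝ → ℝ) : Prop extends GelfandShilov α β f where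
  alpha_pos : 0 < α
  even : ∀ x, f (-x) = f x
  ne_zero : ∃ x, f x ≠ 0

/-- The convolution function `M_{Z,f}(t) = ∫ Z(t + x) f(x / G) dx`. -/
def convM (f : ℝ → ℝ) (G t : ℝ) : ℝ := ∫ x : ℝ, hardyZ (t + x) * f (x / G)

/-- The Fourier transform in the normalization `∫ f(u) exp (2 π i x u) du`. -/
def fourierHat (f : ℝ → ℝ) (x : ℝ) : ℂ :=
  ∫ u : ℝ, (f u : ℂ) * Complex.exp (2 * Real.pi * Complex.I * x * u)

end

/-!
The lower bound comes from testing `M(t) = convM f G t` against a unimodular function that undoes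
the phase of Hardy's function. Near `T`, Stirling's formula (`norm_chiInvSqrt_sub_le`) gives
`Z(t) = exp (i θ(t)) ζ(1/2 + it) + O(|ζ| / t)` with `θ(t) = (t/2) log (t/2π) - t/2 - π/8`, and
`θ(T + v) = θ(T) + v log P + v² / (4T) + O(|v|³ / T²)` (`abs_thetaMain_add_sub_le`). Keeping the
quadratic term leaves a phase error so small that `ζ(1/2 + it) = O(t ^ (1/2))` suffices to control
it.

So let `t = T + u`, and multiply the Gaussian weight by `exp (-i (u log P + u² / (4T)))`
(`rotatedGauss`). For fixed `x`, the average over `u` of `Z(T + u + x)` becomes, up to the constant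
phase `exp (i (θ(T) + x log P))` and small errors, the Gaussian average of `ζ(1/2 + i(T + x + u))`
twisted by the tiny frequency `x / (2T)`. Euler–Maclaurin summation writes `ζ` as `1` plus terms
`n ^ (-s)` with `n ≥ 2`, plus an integral of such terms and negligible remainders
(`norm_riemannZeta_sub_expansion_le`). The Gaussian of width `V` kills each of these terms by a
factor `exp (-V² / 25)`, and truncation at `|u| ≤ VL` costs `exp (-L² / 2)`. Both are smaller than
any power of `T`, since `V / c ≥ L` and `L = (log T) ^ (1/2 + ε)`, so the `T ^ (8/3)` terms that
are needed are harmless and only the `1` survives, contributing `√π V`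
(`norm_intervalIntegral_gauss_mul_zeta_sub_le`).

Integrating against `f (x / G)` (Fubini, and the rapid decay of `f` for large `x`) turns
`exp (i x log P)` into `G` times the Fourier transform of `f` at `(G / 2π) log P`. The main term is
thus `√π G V |f̂|`, with an error `O(G V T ^ (-1/4))`. As `√π ≥ 1`, this proves the bound for large
`T`. For bounded `T` a large `K` makes the left side nonpositive.

The estimates are carried out in terms of `q = T ^ (1/12)`, so that all powers of `T` that occur
are integral powers of `q`.
-/

noncomputable section

open MeasureTheory

/-! ### Stirling's formula for the phase on the critical line -/

/-- The phase `z / ‖z‖` of a complex number. -/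
def unitPhase (z : ℂ) : ℂ := z / (‖z‖ : ℝ)

theorem unitPhase_mul (z w : ℂ) : unitPhase (z * w) = unitPhase z * unitPhase w := by
  simp only [unitPhase, norm_mul, Complex.ofReal_mul]
  rw [mul_div_mul_comm]

theorem unitPhase_exp (z : ℂ) : unitPhase (Complex.exp z) = Complex.exp (Complex.I * z.im) := by
  rw [unitPhase, Complex.norm_exp, Complex.ofReal_exp, ← Complex.exp_sub]
  congr 1
  nth_rewrite 1 [← Complex.re_add_im z]
  ring

theorem unitPhase_continuousAt {z : ℂ} (hz : z ≠ 0) : ContinuousAt unitPhase z := by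
  unfold unitPhase
  refine ContinuousAt.div continuousAt_id (by fun_prop) (by simpa using hz)

theorem norm_exp_I_mul_sub_exp_I_mul_le (a b : ℝ) :
    ‖Complex.exp (Complex.I * a) - Complex.exp (Complex.I * b)‖ ≤ |a - b| := by
  have h : Complex.exp (Complex.I * a) - Complex.exp (Complex.I * b) =
      Complex.exp (Complex.I * b) * (Complex.exp (Complex.I * ((a - b : ℝ) : ℂ)) - 1) := by
    rw [mul_sub, ← Complex.exp_add]
    push_cast
    ring_nf
  rw [h, norm_mul, mul_comm Complex.I (b : ℂ), Complex.norm_exp_ofReal_mul_I, one_mul]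
  exact Real.norm_exp_I_mul_ofReal_sub_one_le

/-- Logarithms add on the right half-plane, where the arguments cannot leave the principal
range. -/
theorem log_mul_of_re_pos {z w : ℂ} (hz : 0 < z.re) (hw : 0 < w.re) :
    Complex.log (z * w) = Complex.log z + Complex.log w := by
  have h1 := abs_lt.1 (Complex.abs_arg_lt_pi_div_two_iff.2 (Or.inl hz))
  have h2 := abs_lt.1 (Complex.abs_arg_lt_pi_div_two_iff.2 (Or.inl hw))
  refine (Complex.log_mul_eq_add_log_iff ?_ ?_).2 ⟨by linarith, by linarith⟩
  · rintro rfl; simp at hz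
  · rintro rfl; simp at hw

/-- The main part `(w - 1/2) log w - w` of Stirling's expansion of `log Γ(w)`. -/
def stirlingMain (w : ℂ) : ℂ := (w - 1 / 2) * Complex.log w - w

/-- The defect `S(w + 1) - S(w) - log w` of the functional equation for the Stirling main part
`S`. -/
def stirlingDefect (w : ℂ) : ℂ := stirlingMain (w + 1) - stirlingMain w - Complex.log w

theorem norm_stirlingDefect_le {w : ℂ} (hw : 0 < w.re) (hw2 : 2 ≤ ‖w‖) :
    ‖stirlingDefect w‖ ≤ 2 / ‖w‖ ^ 2 := by
  have hw0 : w ≠ 0 := by rintro rfl; simp at hw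
  set z : ℂ := w⁻¹ with hz
  have hzn : ‖z‖ ≤ 1 / 2 := by
    rw [hz, norm_inv]; rw [inv_le_comm₀ (by linarith) (by norm_num)]; simpa using hw2
  have hzre : 0 < (1 + z).re := by
    have := Complex.abs_re_le_norm z
    have := (abs_le.1 this).1
    simp only [Complex.add_re, Complex.one_re]
    linarith
  have hlog : Complex.log (w + 1) = Complex.log w + Complex.log (1 + z) := by
    rw [← log_mul_of_re_pos hw hzre]
    congr 1
    rw [hz]; field_simp
  have hT := Complex.norm_log_sub_logTaylor_le 2 (z := z) (by linarith)
  have hlt : Complex.logTaylor 3 z = z - z ^ 2 / 2 := by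
    simp [Complex.logTaylor_succ, Complex.logTaylor_zero]
    ring
  rw [hlt] at hT
  set R : ℂ := Complex.log (1 + z) - (z - z ^ 2 / 2) with hR
  have hwz : w * z = 1 := by rw [hz]; exact mul_inv_cancel₀ hw0
  have hmain : stirlingDefect w = -z ^ 2 / 4 + (w + 1 / 2) * R := by
    have h1 : Complex.log (1 + z) = z - z ^ 2 / 2 + R := by rw [hR]; ring
    rw [stirlingDefect, stirlingMain, stirlingMain, hlog, h1]
    linear_combination (1 - z / 2) * hwz
  have hwn : ‖w‖ * ‖z‖ = 1 := by rw [← norm_mul, hwz, norm_one]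
  have hzpos : 0 ≤ ‖z‖ := norm_nonneg z
  have hinv : (1 - ‖z‖)⁻¹ ≤ 2 := by
    rw [inv_le_comm₀ (by linarith) (by norm_num)]; linarith
  have hRn : ‖R‖ ≤ ‖z‖ ^ 3 := by
    refine hT.trans ?_
    have h3 : 0 ≤ ‖z‖ ^ 3 := by positivity
    have : ‖z‖ ^ 3 * (1 - ‖z‖)⁻¹ ≤ ‖z‖ ^ 3 * 2 := mul_le_mul_of_nonneg_left hinv h3
    norm_num at this ⊢
    linarith
  have hz2 : 2 / ‖w‖ ^ 2 = 2 * ‖z‖ ^ 2 := by rw [hz, norm_inv]; field_simp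
  rw [hz2, hmain]
  have h1 : ‖-z ^ 2 / 4 + (w + 1 / 2) * R‖ ≤ ‖z‖ ^ 2 / 4 + (‖w‖ + 1 / 2) * ‖z‖ ^ 3 := by
    refine (norm_add_le _ _).trans (add_le_add ?_ ?_)
    · simp
    · rw [norm_mul]
      refine mul_le_mul ((norm_add_le _ _).trans ?_) hRn (norm_nonneg _) (by positivity)
      simp
  refine h1.trans ?_
  have h2 : (‖w‖ + 1 / 2) * ‖z‖ ^ 3 = ‖z‖ ^ 2 + ‖z‖ * ‖z‖ ^ 2 / 2 := by
    linear_combination ‖z‖ ^ 2 * hwn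
  nlinarith [sq_nonneg ‖z‖]

/-- Summing the defect telescopes, because `1 / (k² + τ²)` is dominated by a telescoping term. -/
theorem norm_sum_stirlingDefect_le {w : ℂ} (hw : 0 < w.re) (hw2 : 2 ≤ w.im) (n : ℕ) :
    ‖∑ k ∈ Finset.range n, stirlingDefect (w + k)‖ ≤ 8 / w.im := by
  set τ := w.im with hτ
  have key : ∀ k : ℕ, ‖stirlingDefect (w + k)‖ ≤
      4 * (1 / (k + τ - 1) - 1 / ((k + 1 : ℕ) + τ - 1)) := by
    intro k
    have hk : (0 : ℝ) ≤ k := k.cast_nonneg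
    have hre : (w + k).re = w.re + k := by simp
    have him : (w + k).im = τ := by simp [hτ]
    have h2 : 2 ≤ ‖w + k‖ := by
      have := Complex.abs_im_le_norm (w + k)
      rw [him] at this
      exact hw2.trans ((le_abs_self _).trans this)
    refine (norm_stirlingDefect_le (by rw [hre]; linarith) h2).trans ?_
    have hsq : ‖w + k‖ ^ 2 = (w.re + k) ^ 2 + τ ^ 2 := by
      rw [Complex.sq_norm, Complex.normSq_apply, hre, him]; ring
    rw [hsq]
    have h4 : 4 * (1 / (k + τ - 1) - 1 / ((k + 1 : ℕ) + τ - 1)) = 4 / ((k + τ - 1) * (k + τ)) := by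
      have h5 : (k : ℝ) + τ - 1 ≠ 0 := by linarith
      have h6 : (k : ℝ) + τ ≠ 0 := by linarith
      have h7 : ((k + 1 : ℕ) : ℝ) + τ - 1 = k + τ := by push_cast; ring
      rw [h7]; field_simp; ring
    rw [h4, div_le_div_iff₀ (by positivity) (mul_pos (by linarith) (by linarith))]
    nlinarith [sq_nonneg ((k : ℝ) - τ), mul_nonneg hw.le hk, sq_nonneg w.re]
  calc ‖∑ k ∈ Finset.range n, stirlingDefect (w + k)‖
      ≤ ∑ k ∈ Finset.range n, ‖stirlingDefect (w + k)‖ := norm_sum_le _ _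
    _ ≤ ∑ k ∈ Finset.range n, 4 * (1 / ((k : ℝ) + τ - 1) - 1 / ((k + 1 : ℕ) + τ - 1)) :=
        Finset.sum_le_sum fun k _ => key k
    _ = 4 * (1 / (τ - 1) - 1 / (n + τ - 1)) := by
        rw [← Finset.mul_sum, Finset.sum_range_sub' (fun k : ℕ => 1 / ((k : ℝ) + τ - 1))]
        simp
    _ ≤ 8 / τ := by
        have hn : (0 : ℝ) ≤ n := n.cast_nonneg
        have h1 : 0 ≤ 1 / ((n : ℝ) + τ - 1) := div_nonneg zero_le_one (by linarith)
        have h2 : 1 / (τ - 1) ≤ 2 / τ := by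
          rw [div_le_div_iff₀ (by linarith) (by linarith)]; linarith
        have : 8 / τ = 4 * (2 / τ) := by ring
        rw [this]
        linarith

/-- Comparison of `w log n` with the Stirling main part far to the right, where only imaginary parts
matter: the real terms, such as `(n + 1/2) log n`, drop out. -/
theorem tendsto_im_stirlingMain {w : ℂ} (hw : 0 < w.re) :
    Filter.Tendsto (fun n : ℕ => (w * Complex.log n - stirlingMain (w + (n + 1 : ℕ))).im)
      Filter.atTop (nhds 0) := by
  have hlim : Filter.Tendsto (fun x : ℝ => (x : ℂ) * Complex.log (1 + (w + 1) / x)) Filter.atTop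
      (nhds (w + 1)) := by
    refine Complex.tendsto_mul_log_one_add_of_tendsto ?_
    refine tendsto_const_nhds.congr' ?_
    filter_upwards [Filter.eventually_gt_atTop 0] with x hx
    have : (x : ℂ) ≠ 0 := by exact_mod_cast hx.ne'
    field_simp
  have hlim0 : Filter.Tendsto (fun x : ℝ => Complex.log (1 + (w + 1) / x)) Filter.atTop
      (nhds 0) := by
    have h1 : Filter.Tendsto (fun x : ℝ => ((x : ℂ))⁻¹) Filter.atTop (nhds 0) := by
      have := (Complex.continuous_ofReal.tendsto 0).comp tendsto_inv_atTop_zero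
      simpa [Function.comp_def] using this
    have h2 := h1.mul hlim
    rw [zero_mul] at h2
    refine h2.congr' ?_
    filter_upwards [Filter.eventually_gt_atTop 0] with x hx
    have : (x : ℂ) ≠ 0 := by exact_mod_cast hx.ne'
    rw [← mul_assoc, inv_mul_cancel₀ this, one_mul]
  have hl : Filter.Tendsto (fun x : ℝ => (w - (x + (w + 1 / 2)) * Complex.log (1 + (w + 1) / x)).im)
      Filter.atTop (nhds 0) := by
    have h1 : Filter.Tendsto (fun x : ℝ => w - (x * Complex.log (1 + (w + 1) / x)
        + (w + 1 / 2) * Complex.log (1 + (w + 1) / x))) Filter.atTop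
        (nhds (w - ((w + 1) + (w + 1 / 2) * 0))) :=
      tendsto_const_nhds.sub (hlim.add (hlim0.const_mul _))
    have h2 := (Complex.continuous_im.tendsto _).comp h1
    simp only [mul_zero, add_zero, Function.comp_def] at h2
    have h3 : (w - (w + 1)).im = 0 := by simp
    rw [h3] at h2
    refine h2.congr fun x => ?_
    congr 1; ring
  refine (hl.comp tendsto_natCast_atTop_atTop).congr' ?_
  filter_upwards [Filter.eventually_gt_atTop 0] with n hn
  have hn' : (0 : ℝ) < n := by exact_mod_cast hn
  have hnc : (n : ℂ) ≠ 0 := by exact_mod_cast hn'.ne'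
  have hlog : Complex.log (w + (n + 1 : ℕ)) = Complex.log n + Complex.log (1 + (w + 1) / n) := by
    rw [← log_mul_of_re_pos (by simpa using hn')]
    · congr 1
      push_cast
      field_simp
      ring
    · have : (w + 1) / (n : ℂ) = (w + 1) / ((n : ℝ) : ℂ) := by push_cast; rfl
      rw [this, Complex.add_re, Complex.div_ofReal_re, Complex.one_re, Complex.add_re,
        Complex.one_re]
      positivity
  have hreal : (Complex.log n).im = 0 := by
    rw [← Complex.ofReal_natCast, ← Complex.ofReal_log hn'.le, Complex.ofReal_im]
  simp only [Function.comp_apply]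
  have h : w * Complex.log n - stirlingMain (w + (n + 1 : ℕ)) =
      (w - (((n : ℝ) : ℂ) + (w + 1 / 2)) * Complex.log (1 + (w + 1) / ((n : ℝ) : ℂ)))
        + (((n + 1 : ℝ) : ℂ) - ((n + 1 / 2 : ℝ) : ℂ) * Complex.log n) := by
    rw [stirlingMain, hlog]
    push_cast
    ring
  rw [h, Complex.add_im _ (_ - _), Complex.sub_im (((n + 1 : ℝ) : ℂ)), Complex.ofReal_im,
    Complex.im_ofReal_mul, hreal]
  simp

/-- The phase of Euler's product for `Γ(w)`, with `∑ log (w + k)` telescoped through the Stirling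
main part. -/
theorem unitPhase_GammaSeq {w : ℂ} (hw : 0 < w.re) {n : ℕ} (hn : 0 < n) :
    unitPhase (Complex.GammaSeq w n) = Complex.exp (Complex.I * (((stirlingMain w).im
      + (w * Complex.log n - stirlingMain (w + (n + 1 : ℕ))).im
      + (∑ k ∈ Finset.range (n + 1), stirlingDefect (w + k)).im : ℝ) : ℂ)) := by
  have hnc : (n : ℂ) ≠ 0 := by exact_mod_cast hn.ne'
  have hne : ∀ j : ℕ, w + j ≠ 0 := fun j h => by
    have := congrArg Complex.re h
    simp at this
    have : (0 : ℝ) ≤ j := j.cast_nonneg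
    linarith
  have hprod : ∏ j ∈ Finset.range (n + 1), (w + j) =
      Complex.exp (∑ j ∈ Finset.range (n + 1), Complex.log (w + j)) := by
    rw [Complex.exp_sum]
    exact Finset.prod_congr rfl fun j _ => (Complex.exp_log (hne j)).symm
  have hfac : ((n.factorial : ℕ) : ℂ) = Complex.exp ((Real.log n.factorial : ℝ) : ℂ) := by
    rw [← Complex.ofReal_exp, Real.exp_log (by exact_mod_cast n.factorial_pos)]
    simp
  have hsum : ∑ j ∈ Finset.range (n + 1), Complex.log (w + j) =
      stirlingMain (w + (n + 1 : ℕ)) - stirlingMain w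
        - ∑ k ∈ Finset.range (n + 1), stirlingDefect (w + k) := by
    have h1 := Finset.sum_range_sub (fun k : ℕ => stirlingMain (w + k)) (n + 1)
    simp only [Nat.cast_zero, add_zero] at h1
    rw [← h1, ← Finset.sum_sub_distrib]
    refine Finset.sum_congr rfl fun j _ => ?_
    rw [stirlingDefect]
    push_cast
    ring_nf
  have hG : Complex.GammaSeq w n = Complex.exp (Complex.log n * w + (Real.log n.factorial : ℝ)
      - ∑ j ∈ Finset.range (n + 1), Complex.log (w + j)) := by
    rw [Complex.GammaSeq, hprod, Complex.cpow_def_of_ne_zero hnc, hfac, ← Complex.exp_add,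
      ← Complex.exp_sub]
  rw [hG, unitPhase_exp, hsum]
  congr 3
  simp only [Complex.sub_im, Complex.add_im, Complex.ofReal_im]
  rw [mul_comm (Complex.log n) w]
  ring

/-- Stirling's formula for the phase of `Γ` in the right half-plane. -/
theorem norm_unitPhase_Gamma_sub_le {w : ℂ} (hw : 0 < w.re) (hw2 : 2 ≤ w.im) :
    ‖unitPhase (Complex.Gamma w) - Complex.exp (Complex.I * ((stirlingMain w).im : ℝ))‖
      ≤ 8 / w.im := by
  have h1 : Filter.Tendsto (fun n : ℕ => ‖unitPhase (Complex.GammaSeq w n)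
      - Complex.exp (Complex.I * ((stirlingMain w).im : ℝ))‖) Filter.atTop
      (nhds ‖unitPhase (Complex.Gamma w) - Complex.exp (Complex.I * ((stirlingMain w).im : ℝ))‖) :=
    (((unitPhase_continuousAt (Complex.Gamma_ne_zero_of_re_pos hw)).tendsto.comp
      (Complex.GammaSeq_tendsto_Gamma w)).sub_const _).norm
  have h2 : Filter.Tendsto (fun n : ℕ =>
      |(w * Complex.log n - stirlingMain (w + (n + 1 : ℕ))).im| + 8 / w.im) Filter.atTop
      (nhds (|0| + 8 / w.im)) := (tendsto_im_stirlingMain hw).abs.add_const _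
  rw [abs_zero, zero_add] at h2
  refine le_of_tendsto_of_tendsto h1 h2 ?_
  filter_upwards [Filter.eventually_gt_atTop 0] with n hn
  rw [unitPhase_GammaSeq hw hn]
  refine (norm_exp_I_mul_sub_exp_I_mul_le _ _).trans ?_
  rw [add_assoc, add_sub_cancel_left]
  refine (abs_add_le _ _).trans (add_le_add le_rfl ?_)
  exact (Complex.abs_im_le_norm _).trans (norm_sum_stirlingDefect_le hw hw2 _)

/-- The main part `(t/2) log (t/2π) - t/2 - π/8` of the Riemann–Siegel theta function. -/
def thetaMain (t : ℝ) : ℝ := t / 2 * Real.log (t / (2 * Real.pi)) - t / 2 - Real.pi / 8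

theorem abs_im_stirlingMain_sub_le {t : ℝ} (ht : 4 ≤ t) :
    |(stirlingMain (1 / 4 + (t / 2 : ℝ) * Complex.I)).im - t / 2 * Real.log Real.pi - thetaMain t|
      ≤ 1 / t := by
  set τ : ℝ := t / 2 with hτ
  have hτ2 : 2 ≤ τ := by rw [hτ]; linarith
  have hτ0 : (τ : ℂ) ≠ 0 := by exact_mod_cast (by linarith : τ ≠ 0)
  set z : ℂ := -Complex.I / (4 * τ) with hz
  have hzn : ‖z‖ = 1 / (4 * τ) := by
    rw [hz, norm_div, norm_neg, Complex.norm_I, norm_mul, Complex.norm_real,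
      Real.norm_of_nonneg (by linarith)]
    simp
  have hzn' : ‖z‖ ≤ 1 / 8 := by
    rw [hzn, div_le_div_iff₀ (by linarith) (by norm_num)]; linarith
  have hzre : z.re = 0 := by
    rw [hz, show (4 * (τ : ℂ)) = ((4 * τ : ℝ) : ℂ) by push_cast; rfl, Complex.div_ofReal_re]
    simp
  have hfac : (1 / 4 + (τ : ℂ) * Complex.I) = (τ * Complex.I) * (1 + z) := by
    rw [hz]; field_simp; linear_combination Complex.I_sq
  have hargI : (τ * Complex.I).arg = Real.pi / 2 := by
    rw [Complex.arg_real_mul _ (by linarith), Complex.arg_I]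
  have hlog : Complex.log (1 / 4 + (τ : ℂ) * Complex.I) =
      Real.log τ + (Real.pi / 2) * Complex.I + Complex.log (1 + z) := by
    have h2 := abs_lt.1 (Complex.abs_arg_lt_pi_div_two_iff.2
      (Or.inl (show 0 < (1 + z).re by simp [hzre])))
    have hw : (1 / 4 + (τ : ℂ) * Complex.I) ≠ 0 := fun h => by
      have := congrArg Complex.re h
      norm_num at this
    have h1z : 1 + z ≠ 0 := fun h => hw (by rw [hfac, h, mul_zero])
    have hIt : (τ : ℂ) * Complex.I ≠ 0 := mul_ne_zero hτ0 Complex.I_ne_zero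
    have hpi := Real.pi_pos
    by_cases harg : (1 + z).arg ≤ Real.pi / 2
    · rw [hfac, (Complex.log_mul_eq_add_log_iff hIt h1z).2 (by
        rw [hargI]; exact ⟨by linarith, by linarith⟩)]
      congr 1
      rw [Complex.log, hargI, norm_mul, Complex.norm_I, Complex.norm_real,
        Real.norm_of_nonneg (by linarith), mul_one]
      push_cast
      rfl
    · exact absurd h2.2.le harg
  have hR := Complex.norm_log_one_add_sub_self_le (z := z) (by linarith)
  set R : ℂ := Complex.log (1 + z) - z with hRdef
  have hRn : ‖R‖ ≤ ‖z‖ ^ 2 := by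
    refine hR.trans ?_
    have hinv : (1 - ‖z‖)⁻¹ ≤ 2 := by
      rw [inv_le_comm₀ (by linarith) (by norm_num)]; linarith
    have := mul_le_mul_of_nonneg_left hinv (sq_nonneg ‖z‖)
    linarith
  have hexp : stirlingMain (1 / 4 + (τ : ℂ) * Complex.I) =
      (((-1 / 4) * Real.log τ - τ * Real.pi / 2 : ℝ) : ℂ)
      + ((τ * Real.log τ - Real.pi / 8 - τ : ℝ) : ℂ) * Complex.I
      + (-z / 4 + (-1 / 4 + τ * Complex.I) * R) := by
    have h1 : Complex.log (1 + z) = z + R := by rw [hRdef]; ring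
    have h2 : (τ : ℂ) * Complex.I * z = 1 / 4 := by
      rw [hz]; field_simp; linear_combination -(1 : ℂ) * Complex.I_sq
    rw [stirlingMain, hlog, h1]
    push_cast
    linear_combination (τ : ℂ) * (Real.pi / 2) * Complex.I_sq + h2
  have hlogτ : Real.log (t / (2 * Real.pi)) = Real.log τ - Real.log Real.pi := by
    rw [← Real.log_div (by linarith) Real.pi_ne_zero, hτ]
    congr 1; field_simp
  have hmain : (stirlingMain (1 / 4 + (τ : ℂ) * Complex.I)).im - τ * Real.log Real.pi - thetaMain t
      = (-z / 4 + (-1 / 4 + τ * Complex.I) * R).im := by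
    rw [hexp, Complex.add_im, Complex.add_im, Complex.ofReal_im, Complex.im_ofReal_mul,
      Complex.I_im, thetaMain, hlogτ, ← hτ]
    ring
  rw [hmain]
  refine (Complex.abs_im_le_norm _).trans ((norm_add_le _ _).trans ?_)
  have h1 : ‖-z / 4‖ = ‖z‖ / 4 := by simp
  have h2 : ‖(-1 / 4 + τ * Complex.I) * R‖ ≤ (1 / 4 + τ) * ‖z‖ ^ 2 := by
    rw [norm_mul]
    refine mul_le_mul ((norm_add_le _ _).trans ?_) hRn (norm_nonneg _) (by positivity)
    rw [norm_mul, Complex.norm_I, Complex.norm_real, Real.norm_of_nonneg (by linarith)]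
    norm_num
  have h3 : 1 / t = 2 * ‖z‖ := by rw [hzn, hτ]; field_simp; norm_num
  have h4 : τ * ‖z‖ = 1 / 4 := by rw [hzn]; field_simp
  rw [h1, h3]
  refine (add_le_add le_rfl h2).trans ?_
  have h5 : (1 / 4 + τ) * ‖z‖ ^ 2 = ‖z‖ ^ 2 / 4 + ‖z‖ / 4 := by linear_combination ‖z‖ * h4
  rw [h5]
  nlinarith [norm_nonneg z]

/-- Stirling's formula on the critical line: `χ(1/2 + it) ^ (-1/2) = exp (i θ(t)) + O(1 / t)`. -/
theorem norm_chiInvSqrt_sub_le {t : ℝ} (ht : 4 ≤ t) :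
    ‖chiInvSqrt t - Complex.exp (Complex.I * (thetaMain t : ℝ))‖ ≤ 17 / t := by
  have hw : (1 / 2 + t * Complex.I) / 2 = 1 / 4 + ((t / 2 : ℝ) : ℂ) * Complex.I := by
    push_cast; ring
  set w : ℂ := 1 / 4 + ((t / 2 : ℝ) : ℂ) * Complex.I with hwdef
  have hre : w.re = 1 / 4 := by simp [hwdef]
  have him : w.im = t / 2 := by simp [hwdef]
  have hχ : chiInvSqrt t = Complex.exp (Complex.I * ((-(t / 2 * Real.log Real.pi) : ℝ) : ℂ))
      * unitPhase (Complex.Gamma w) := by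
    have h1 : chiInvSqrt t = unitPhase (Complex.Gammaℝ (1 / 2 + t * Complex.I)) := rfl
    have hpi : (Real.pi : ℂ) ≠ 0 := by exact_mod_cast Real.pi_ne_zero
    rw [h1, Complex.Gammaℝ_def, unitPhase_mul, hw, Complex.cpow_def_of_ne_zero hpi, unitPhase_exp,
      neg_div, hw, ← Complex.ofReal_log Real.pi_pos.le, Complex.im_ofReal_mul, Complex.neg_im, him]
    congr 4
    ring
  have hS := norm_unitPhase_Gamma_sub_le (w := w) (by rw [hre]; norm_num) (by rw [him]; linarith)
  have hM := abs_im_stirlingMain_sub_le ht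
  rw [← hwdef] at hM
  rw [him] at hS
  set a : ℝ := -(t / 2 * Real.log Real.pi) with ha
  have hsplit : chiInvSqrt t - Complex.exp (Complex.I * (thetaMain t : ℝ)) =
      Complex.exp (Complex.I * (a : ℂ)) * (unitPhase (Complex.Gamma w)
        - Complex.exp (Complex.I * ((stirlingMain w).im : ℝ)))
      + (Complex.exp (Complex.I * (((stirlingMain w).im + a : ℝ) : ℂ))
        - Complex.exp (Complex.I * (thetaMain t : ℝ))) := by
    rw [hχ, mul_sub, ← Complex.exp_add]
    push_cast
    ring_nf
  rw [hsplit]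
  refine (norm_add_le _ _).trans ?_
  rw [norm_mul, mul_comm Complex.I (a : ℂ), Complex.norm_exp_ofReal_mul_I, one_mul]
  refine (add_le_add hS (norm_exp_I_mul_sub_exp_I_mul_le _ _)).trans ?_
  have h2 : (stirlingMain w).im + a - thetaMain t =
      (stirlingMain w).im - t / 2 * Real.log Real.pi - thetaMain t := by rw [ha]; ring
  rw [h2]
  have h3 : 8 / (t / 2) = 16 / t := by field_simp; norm_num
  have h4 : 17 / t = 16 / t + 1 / t := by ring
  rw [h3, h4]
  exact add_le_add le_rfl hM

/-- Second order Taylor expansion of the phase at `T`. -/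
theorem abs_thetaMain_add_sub_le {T v : ℝ} (hT : 0 < T) (hv : |v| ≤ T / 2) :
    |thetaMain (T + v) - (thetaMain T + v * Real.log (Real.sqrt (T / (2 * Real.pi)))
      + v ^ 2 / (4 * T))| ≤ |v| ^ 3 / T ^ 2 := by
  set z : ℝ := v / T with hz
  have hvz : v = T * z := by rw [hz]; field_simp
  have hzabs : |z| ≤ 1 / 2 := by
    rw [hz, abs_div, abs_of_pos hT, div_le_iff₀ hT]; linarith
  have hz1 : 0 < 1 + z := by linarith [(abs_le.1 hzabs).1]
  have hpi := Real.pi_pos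
  have hsq : Real.log (Real.sqrt (T / (2 * Real.pi))) = Real.log (T / (2 * Real.pi)) / 2 :=
    Real.log_sqrt (by positivity)
  have hlog : Real.log ((T + v) / (2 * Real.pi)) = Real.log (T / (2 * Real.pi))
      + Real.log (1 + z) := by
    rw [← Real.log_mul (by positivity) hz1.ne']
    congr 1
    rw [hvz]; ring
  have hR : |Real.log (1 + z) - (z - z ^ 2 / 2)| ≤ |z| ^ 3 * (2 / 3) := by
    have h := Complex.norm_log_sub_logTaylor_le 2 (z := (z : ℂ))
      (by rw [Complex.norm_real, Real.norm_eq_abs]; linarith)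
    have hlt : Complex.logTaylor 3 (z : ℂ) = z - z ^ 2 / 2 := by
      simp [Complex.logTaylor_succ, Complex.logTaylor_zero]
      ring
    have hcast : Complex.log (1 + (z : ℂ)) - (z - z ^ 2 / 2) =
        ((Real.log (1 + z) - (z - z ^ 2 / 2) : ℝ) : ℂ) := by
      push_cast [Complex.ofReal_log hz1.le]
      rfl
    rw [hlt, hcast, Complex.norm_real, Complex.norm_real, Real.norm_eq_abs, Real.norm_eq_abs] at h
    refine h.trans ?_
    have hinv : (1 - |z|)⁻¹ ≤ 2 := by
      rw [inv_le_comm₀ (by linarith) (by norm_num)]; linarith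
    have h3 : 0 ≤ |z| ^ 3 := by positivity
    have := mul_le_mul_of_nonneg_left hinv h3
    norm_num at this ⊢
    linarith
  set R : ℝ := Real.log (1 + z) - (z - z ^ 2 / 2) with hRdef
  have hmain : thetaMain (T + v) - (thetaMain T + v * Real.log (Real.sqrt (T / (2 * Real.pi)))
      + v ^ 2 / (4 * T)) = T / 2 * ((1 + z) * R - z ^ 3 / 2) := by
    have h1 : Real.log (1 + z) = z - z ^ 2 / 2 + R := by rw [hRdef]; ring
    rw [thetaMain, thetaMain, hlog, hsq, h1, hvz]
    field_simp
    ring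
  have htgt : |v| ^ 3 / T ^ 2 = T * |z| ^ 3 := by
    rw [hz, abs_div, abs_of_pos hT]; field_simp
  rw [hmain, htgt, abs_mul, abs_of_pos (by positivity : 0 < T / 2)]
  have h3 : 0 ≤ |z| ^ 3 := by positivity
  have h5 : |(1 + z) * R - z ^ 3 / 2| ≤ (3 / 2) * (|z| ^ 3 * (2 / 3)) + |z| ^ 3 / 2 := by
    refine (abs_sub _ _).trans (add_le_add ?_ ?_)
    · rw [abs_mul]
      refine mul_le_mul ?_ hR (abs_nonneg _) (by norm_num)
      rw [abs_of_pos hz1]; linarith [(abs_le.1 hzabs).2]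
    · rw [abs_div, abs_pow]; norm_num
  nlinarith

/-! ### Approximation and bounds for `ζ` on the critical line -/

/-- `s - 1` times the difference between `(n + 1) ^ (-s)` and `∫ x in n..n + 1, x ^ (-s)`, written
without the integral, so that it is visibly entire in `s`. -/
def zetaIncrement (n : ℕ) (s : ℂ) : ℂ :=
  (s - 1) * ((n : ℂ) + 1) ^ (-s) + (((n : ℂ) + 1) ^ (1 - s) - (n : ℂ) ^ (1 - s))

theorem zetaIncrement_eq {n : ℕ} (hn : 1 ≤ n) {s : ℂ} (hs : s ≠ 1) : zetaIncrement n s =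
    (s - 1) * ∫ x in (n : ℝ)..(n + 1), (((n : ℂ) + 1) ^ (-s) - (x : ℂ) ^ (-s)) := by
  have hn' : (1 : ℝ) ≤ n := by exact_mod_cast hn
  have h0 : (0 : ℝ) ∉ Set.uIcc (n : ℝ) (n + 1) := by
    rw [Set.uIcc_of_le (by linarith)]
    exact fun h => by linarith [h.1]
  have hs' : 1 - s ≠ 0 := sub_ne_zero.2 hs.symm
  have hint := integral_cpow (a := (n : ℝ)) (b := n + 1) (r := -s)
    (Or.inr ⟨fun h => hs (neg_injective h), h0⟩)
  rw [intervalIntegral.integral_sub intervalIntegrable_const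
    (intervalIntegral.intervalIntegrable_cpow (Or.inr h0)), hint, zetaIncrement,
    intervalIntegral.integral_const, add_sub_cancel_left, one_smul]
  have : -s + 1 = 1 - s := by ring
  rw [this]
  push_cast
  field_simp
  ring

/-- Mean value theorem for `x ^ (-s)` on `[n, n + 1]`. -/
theorem norm_zetaIncrement_le {n : ℕ} (hn : 1 ≤ n) {s : ℂ} (hs : 0 ≤ s.re) :
    ‖zetaIncrement n s‖ ≤ ‖s - 1‖ * (‖s‖ * (n : ℝ) ^ (-s.re - 1)) := by
  by_cases h1 : s = 1
  · subst h1
    have : (n : ℂ) ≠ 0 := by exact_mod_cast (by omega : n ≠ 0)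
    simp [zetaIncrement]
  have hn' : (1 : ℝ) ≤ n := by exact_mod_cast hn
  rw [zetaIncrement_eq hn h1, norm_mul]
  refine mul_le_mul_of_nonneg_left ?_ (norm_nonneg _)
  have hle : (n : ℝ) ≤ n + 1 := by linarith
  have hmv : ∀ x ∈ Set.Icc (n : ℝ) (n + 1),
      ‖((n : ℂ) + 1) ^ (-s) - (x : ℂ) ^ (-s)‖ ≤ ‖s‖ * (n : ℝ) ^ (-s.re - 1) := by
    intro x hx
    have hd : ∀ y ∈ Set.Icc (n : ℝ) (n + 1), HasDerivWithinAt (fun y : ℝ => (y : ℂ) ^ (-s))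
        (-s * (y : ℂ) ^ (-s - 1)) (Set.Icc (n : ℝ) (n + 1)) y := by
      intro y hy
      have hy0 : 0 < y := by linarith [hy.1]
      have := (hasDerivAt_id (y : ℂ)).cpow_const (c := -s)
        (Complex.ofReal_mem_slitPlane.2 hy0)
      simp only [id, mul_one] at this
      exact this.comp_ofReal.hasDerivWithinAt
    have hb : ∀ y ∈ Set.Icc (n : ℝ) (n + 1), ‖-s * (y : ℂ) ^ (-s - 1)‖ ≤
        ‖s‖ * (n : ℝ) ^ (-s.re - 1) := by
      intro y hy
      have hy0 : 0 < y := by linarith [hy.1]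
      rw [norm_mul, norm_neg, Complex.norm_cpow_eq_rpow_re_of_pos hy0]
      refine mul_le_mul_of_nonneg_left ?_ (norm_nonneg _)
      have : (-s - 1).re = -s.re - 1 := by simp
      rw [this]
      exact Real.rpow_le_rpow_of_nonpos (by linarith) hy.1 (by linarith)
    have := Convex.norm_image_sub_le_of_norm_hasDerivWithin_le hd hb (convex_Icc _ _) hx
      (Set.right_mem_Icc.2 hle)
    push_cast at this
    refine this.trans ?_
    have h2 : ‖(n : ℝ) + 1 - x‖ ≤ 1 := by
      rw [Real.norm_eq_abs, abs_le]; constructor <;> linarith [hx.1, hx.2]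
    exact mul_le_of_le_one_right (by positivity) h2
  have := intervalIntegral.norm_integral_le_of_norm_le_const (a := (n : ℝ)) (b := n + 1)
    (f := fun x : ℝ => ((n : ℂ) + 1) ^ (-s) - (x : ℂ) ^ (-s)) (fun x hx => hmv x (by
      rw [Set.uIoc_of_le hle] at hx; exact ⟨hx.1.le, hx.2⟩))
  simpa using this

theorem summable_natCast_add_rpow {p : ℝ} (hp : p < -1) (N : ℕ) :
    Summable fun k : ℕ => ((N + k : ℕ) : ℝ) ^ p := by
  have := (summable_nat_add_iff N).2 (Real.summable_nat_rpow.2 hp)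
  exact this.congr fun k => by rw [add_comm]

theorem sum_zetaIncrement (N M : ℕ) (s : ℂ) : ∑ k ∈ Finset.range M, zetaIncrement (N + k) s =
    (s - 1) * ∑ k ∈ Finset.range M, (((N + k : ℕ) : ℂ) + 1) ^ (-s)
      + (((N + M : ℕ) : ℂ) ^ (1 - s) - (N : ℂ) ^ (1 - s)) := by
  induction M with
  | zero => simp
  | succ M ih =>
    rw [Finset.sum_range_succ, ih, Finset.sum_range_succ, zetaIncrement]
    push_cast
    ring_nf

theorem riemannZeta_eq_of_one_lt_re {N : ℕ} (hN : 1 ≤ N) {s : ℂ} (hs : 1 < s.re) :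
    riemannZeta₁ s = (s - 1) * ∑ k ∈ Finset.range N, ((k : ℂ) + 1) ^ (-s) + (N : ℂ) ^ (1 - s)
      + ∑' k : ℕ, zetaIncrement (N + k) s := by
  have hs1 : s ≠ 1 := by rintro rfl; simp at hs
  have hsum : Summable fun k : ℕ => zetaIncrement (N + k) s := by
    refine Summable.of_norm_bounded (((summable_natCast_add_rpow (p := -s.re - 1) (by linarith)
      N).mul_left ‖s‖).mul_left ‖s - 1‖) fun k => ?_
    exact norm_zetaIncrement_le (by omega) (by linarith)
  have hz : Summable fun k : ℕ => ((k : ℂ) + 1) ^ (-s) := by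
    have h := (summable_nat_add_iff 1).2 (Complex.summable_one_div_nat_cpow.2 hs)
    refine h.congr fun k => ?_
    rw [Complex.cpow_neg, one_div]
    push_cast
    rfl
  have hzeta : riemannZeta s = ∑' k : ℕ, ((k : ℂ) + 1) ^ (-s) := by
    rw [zeta_eq_tsum_one_div_nat_add_one_cpow hs]
    exact tsum_congr fun k => by rw [Complex.cpow_neg, one_div]
  have ht1 := hsum.hasSum.tendsto_sum_nat
  have ht2 : Filter.Tendsto (fun M : ℕ => ∑ k ∈ Finset.range M, zetaIncrement (N + k) s)
      Filter.atTop (nhds ((s - 1) * (∑' k : ℕ, (((N + k : ℕ) : ℂ) + 1) ^ (-s))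
        + (0 - (N : ℂ) ^ (1 - s)))) := by
    simp_rw [sum_zetaIncrement]
    refine Filter.Tendsto.add (Filter.Tendsto.const_mul _ ?_) (Filter.Tendsto.sub_const ?_ _)
    · have h := (summable_nat_add_iff N).2 hz
      have h' : Summable fun k : ℕ => (((N + k : ℕ) : ℂ) + 1) ^ (-s) :=
        h.congr fun k => by rw [add_comm k N]
      exact h'.hasSum.tendsto_sum_nat
    · rw [tendsto_zero_iff_norm_tendsto_zero]
      have h1 : Filter.Tendsto (fun x : ℝ => x ^ (-(s.re - 1))) Filter.atTop (nhds 0) :=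
        tendsto_rpow_neg_atTop (by linarith)
      have h2 : Filter.Tendsto (fun M : ℕ => ((N + M : ℕ) : ℝ)) Filter.atTop Filter.atTop :=
        tendsto_natCast_atTop_atTop.comp (Filter.tendsto_add_atTop_nat N |>.congr fun k => by
          rw [add_comm])
      refine (h1.comp h2).congr fun M => ?_
      rw [Complex.norm_natCast_cpow_of_pos (by omega)]
      simp
  have huniq := tendsto_nhds_unique ht1 ht2
  have hsplit := hz.sum_add_tsum_nat_add N
  have hcomm : ∑' k : ℕ, (((k + N : ℕ) : ℂ) + 1) ^ (-s) =
      ∑' k : ℕ, (((N + k : ℕ) : ℂ) + 1) ^ (-s) := tsum_congr fun k => by rw [add_comm k N]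
  rw [hcomm, ← hzeta] at hsplit
  have h3 : riemannZeta₁ s = (s - 1) * riemannZeta s := by
    rw [riemannZeta_eq_inv_sub_mul hs1, mul_inv_cancel_left₀ (sub_ne_zero.2 hs1)]
  rw [h3, huniq, ← hsplit]
  ring

theorem differentiable_zetaIncrement {n : ℕ} (hn : 1 ≤ n) :
    Differentiable ℂ (zetaIncrement n) := by
  have h1 : (n : ℂ) ≠ 0 := by exact_mod_cast (by omega : n ≠ 0)
  have h2 : (n : ℂ) + 1 ≠ 0 := by exact_mod_cast n.succ_ne_zero
  unfold zetaIncrement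
  intro s
  refine DifferentiableAt.add (DifferentiableAt.mul (by fun_prop) ?_) (DifferentiableAt.sub ?_ ?_)
  · exact DifferentiableAt.const_cpow (by fun_prop) (Or.inl h2)
  · exact DifferentiableAt.const_cpow (by fun_prop) (Or.inl h2)
  · exact DifferentiableAt.const_cpow (by fun_prop) (Or.inl h1)

/-- Euler–Maclaurin summation for `ζ`, continued to `Re s > 1/4` by the identity theorem. -/
theorem riemannZeta_eq_of_re {N : ℕ} (hN : 1 ≤ N) {s : ℂ} (hs : 1 / 4 < s.re) :
    riemannZeta₁ s = (s - 1) * ∑ k ∈ Finset.range N, ((k : ℂ) + 1) ^ (-s) + (N : ℂ) ^ (1 - s)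
      + ∑' k : ℕ, zetaIncrement (N + k) s := by
  set R : ℝ := ‖s‖ + 3 with hR
  set U : Set ℂ := {z | 1 / 4 < z.re} ∩ Metric.ball 0 R with hU
  have hUo : IsOpen U := (isOpen_lt continuous_const Complex.continuous_re).inter Metric.isOpen_ball
  have hUc : Convex ℝ U := (convex_halfSpace_re_gt _).inter (convex_ball _ _)
  have hRpos : 3 ≤ R := by rw [hR]; linarith [norm_nonneg s]
  have htsum : DifferentiableOn ℂ (fun w => ∑' k : ℕ, zetaIncrement (N + k) w) U := by
    refine Complex.differentiableOn_tsum_of_summable_norm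
      (u := fun k => (R + 1) * (R * ((N + k : ℕ) : ℝ) ^ (-(5 / 4) : ℝ)))
      (((summable_natCast_add_rpow (by norm_num) N).mul_left _).mul_left _)
      (fun k => (differentiable_zetaIncrement (by omega)).differentiableOn) hUo ?_
    intro k w hw
    have hwn : ‖w‖ ≤ R := by simpa using (Metric.mem_ball.1 hw.2).le
    have hwre : 1 / 4 < w.re := hw.1
    have hnk : (1 : ℝ) ≤ ((N + k : ℕ) : ℝ) := by exact_mod_cast (by omega : 1 ≤ N + k)
    refine (norm_zetaIncrement_le (by omega) (by linarith)).trans ?_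
    have h1 : ‖w - 1‖ ≤ R + 1 := (norm_sub_le _ _).trans (by simpa using hwn)
    have h2 : ((N + k : ℕ) : ℝ) ^ (-w.re - 1) ≤ ((N + k : ℕ) : ℝ) ^ (-(5 / 4) : ℝ) :=
      Real.rpow_le_rpow_of_exponent_le hnk (by linarith)
    gcongr
  have hright : DifferentiableOn ℂ (fun w => (w - 1) * ∑ k ∈ Finset.range N,
      ((k : ℂ) + 1) ^ (-w) + (N : ℂ) ^ (1 - w) + ∑' k : ℕ, zetaIncrement (N + k) w) U := by
    refine DifferentiableOn.add (Differentiable.differentiableOn fun w => ?_) htsum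
    have h1 : (N : ℂ) ≠ 0 := by exact_mod_cast (by omega : N ≠ 0)
    refine DifferentiableAt.add (DifferentiableAt.mul (by fun_prop) ?_)
      (DifferentiableAt.const_cpow (by fun_prop) (Or.inl h1))
    refine DifferentiableAt.fun_sum fun k _ => DifferentiableAt.const_cpow (by fun_prop) (Or.inl ?_)
    exact_mod_cast k.succ_ne_zero
  have hev : riemannZeta₁ =ᶠ[nhds 2] (fun w => (w - 1) * ∑ k ∈ Finset.range N,
      ((k : ℂ) + 1) ^ (-w) + (N : ℂ) ^ (1 - w) + ∑' k : ℕ, zetaIncrement (N + k) w) := by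
    have hopen : IsOpen {z : ℂ | 1 < z.re} := isOpen_lt continuous_const Complex.continuous_re
    filter_upwards [hopen.mem_nhds (show (1 : ℝ) < (2 : ℂ).re by norm_num)] with w hw
    exact riemannZeta_eq_of_one_lt_re hN hw
  have h2U : (2 : ℂ) ∈ U := ⟨by norm_num, by simp; linarith⟩
  have hsU : s ∈ U := ⟨hs, by simp [hR]⟩
  exact AnalyticOnNhd.eqOn_of_preconnected_of_eventuallyEq
    ((differentiable_riemannZeta₁.differentiableOn (s := U)).analyticOnNhd hUo)
    (hright.analyticOnNhd hUo) hUc.isPreconnected h2U hev hsU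

theorem tsum_rpow_neg_three_halves_le {N : ℕ} (hN : 1 ≤ N) :
    ∑' k : ℕ, ((N + k : ℕ) : ℝ) ^ (-(3 / 2) : ℝ) ≤ 4 / Real.sqrt N := by
  have key : ∀ k : ℕ, ((N + k : ℕ) : ℝ) ^ (-(3 / 2) : ℝ) ≤
      4 * (1 / Real.sqrt ((N + k : ℕ) : ℝ) - 1 / Real.sqrt ((N + (k + 1) : ℕ) : ℝ)) := by
    intro k
    have hn : (1 : ℝ) ≤ ((N + k : ℕ) : ℝ) := by exact_mod_cast (by omega : 1 ≤ N + k)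
    have hn1 : ((N + (k + 1) : ℕ) : ℝ) = ((N + k : ℕ) : ℝ) + 1 := by push_cast; ring
    rw [hn1]
    set n : ℝ := ((N + k : ℕ) : ℝ)
    set a := Real.sqrt n with ha
    set b := Real.sqrt (n + 1) with hb
    have haa : a * a = n := Real.mul_self_sqrt (by linarith)
    have hbb : b * b = n + 1 := Real.mul_self_sqrt (by linarith)
    have ha0 : 0 < a := Real.sqrt_pos.2 (by linarith)
    have hb0 : 0 < b := Real.sqrt_pos.2 (by linarith)
    have hpow : n ^ (-(3 / 2) : ℝ) = 1 / a ^ 3 := by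
      rw [Real.rpow_neg (by linarith), ha, Real.sqrt_eq_rpow, ← Real.rpow_natCast,
        ← Real.rpow_mul (by linarith), one_div]
      norm_num
    have hba : b ≤ 3 / 2 * a := by
      refine abs_le_of_sq_le_sq' ?_ (by positivity) |>.2
      nlinarith
    have hdiff : 1 / a - 1 / b = 1 / (a * b * (a + b)) := by
      field_simp
      nlinarith
    rw [hpow, hdiff, mul_one_div, div_le_div_iff₀ (by positivity) (by positivity)]
    have h1 : a * b * (a + b) ≤ a * (3 / 2 * a) * (a + 3 / 2 * a) := by gcongr
    nlinarith [pow_pos ha0 3]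
  refine Real.tsum_le_of_sum_range_le (fun k => by positivity) fun M => ?_
  refine (Finset.sum_le_sum fun k _ => key k).trans ?_
  rw [← Finset.mul_sum, Finset.sum_range_sub' (fun k : ℕ => 1 / Real.sqrt ((N + k : ℕ) : ℝ))]
  have : 0 ≤ 1 / Real.sqrt ((N + M : ℕ) : ℝ) := by positivity
  simp only [add_zero]
  have h4 : 4 / Real.sqrt N = 4 * (1 / Real.sqrt N) := by ring
  rw [h4]
  linarith

/-- Approximation of `ζ` on the critical line by its partial sums. -/
theorem norm_riemannZeta_sub_le {N : ℕ} (hN : 1 ≤ N) {s : ℂ} (hs : s.re = 1 / 2) :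
    ‖riemannZeta s - (∑ k ∈ Finset.range N, ((k : ℂ) + 1) ^ (-s) + (N : ℂ) ^ (1 - s) / (s - 1))‖
      ≤ 4 * ‖s‖ / Real.sqrt N := by
  have hs1 : s ≠ 1 := by rintro rfl; norm_num at hs
  have hs1' : s - 1 ≠ 0 := sub_ne_zero.2 hs1
  have hexp : (-s.re - 1) = (-(3 / 2) : ℝ) := by rw [hs]; norm_num
  have hsum : Summable fun k : ℕ => ((N + k : ℕ) : ℝ) ^ (-(3 / 2) : ℝ) :=
    summable_natCast_add_rpow (by norm_num) N
  have hb : ‖∑' k : ℕ, zetaIncrement (N + k) s‖ ≤ ‖s - 1‖ * (‖s‖ * (4 / Real.sqrt N)) := by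
    refine (tsum_of_norm_bounded (((hsum.mul_left ‖s‖).mul_left ‖s - 1‖).hasSum) fun k => ?_).trans
      ?_
    · rw [← hexp]
      exact norm_zetaIncrement_le (by omega) (by rw [hs]; norm_num)
    · rw [tsum_mul_left, tsum_mul_left]
      gcongr
      exact tsum_rpow_neg_three_halves_le hN
  rw [riemannZeta_eq_inv_sub_mul hs1, riemannZeta_eq_of_re hN (by rw [hs]; norm_num)]
  have h : (s - 1)⁻¹ * ((s - 1) * ∑ k ∈ Finset.range N, ((k : ℂ) + 1) ^ (-s) + (N : ℂ) ^ (1 - s)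
      + ∑' k : ℕ, zetaIncrement (N + k) s)
      - (∑ k ∈ Finset.range N, ((k : ℂ) + 1) ^ (-s) + (N : ℂ) ^ (1 - s) / (s - 1))
      = (s - 1)⁻¹ * ∑' k : ℕ, zetaIncrement (N + k) s := by
    field_simp
    ring
  rw [h, norm_mul, norm_inv]
  have hpos : 0 < ‖s - 1‖ := norm_pos_iff.2 hs1'
  rw [inv_mul_le_iff₀ hpos]
  refine hb.trans (le_of_eq ?_)
  ring

theorem sum_range_one_div_sqrt_le (N : ℕ) :
    ∑ k ∈ Finset.range N, 1 / Real.sqrt ((k : ℝ) + 1) ≤ 2 * Real.sqrt N := by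
  induction N with
  | zero => simp
  | succ n ih =>
    rw [Finset.sum_range_succ]
    push_cast
    have hn : (0 : ℝ) ≤ n := n.cast_nonneg
    set a := Real.sqrt n
    set b := Real.sqrt ((n : ℝ) + 1) with hb
    have haa : a * a = n := Real.mul_self_sqrt hn
    have hbb : b * b = n + 1 := Real.mul_self_sqrt (by linarith)
    have ha0 : 0 ≤ a := Real.sqrt_nonneg _
    have hb0 : 0 < b := Real.sqrt_pos.2 (by linarith)
    have : 1 / b ≤ 2 * b - 2 * a := by
      rw [div_le_iff₀ hb0]
      nlinarith [sq_nonneg (a - b)]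
    linarith

theorem norm_half_add_le (y : ℝ) : ‖(1 / 2 + y * Complex.I : ℂ)‖ ≤ 1 / 2 + |y| := by
  refine (norm_add_le _ _).trans ?_
  simp

theorem abs_le_norm_half_add_sub_one (y : ℝ) : |y| ≤ ‖(1 / 2 + y * Complex.I - 1 : ℂ)‖ := by
  have := Complex.abs_im_le_norm (1 / 2 + y * Complex.I - 1 : ℂ)
  simpa using this

theorem half_le_norm_half_add_sub_one (y : ℝ) : 1 / 2 ≤ ‖(1 / 2 + y * Complex.I - 1 : ℂ)‖ := by
  have := Complex.abs_re_le_norm (1 / 2 + y * Complex.I - 1 : ℂ)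
  have h : (1 / 2 + y * Complex.I - 1 : ℂ).re = -(1 / 2) := by simp; norm_num
  rw [h, abs_neg, abs_of_pos (by norm_num)] at this
  exact this

theorem norm_riemannZeta_half_le (y : ℝ) :
    ‖riemannZeta (1 / 2 + y * Complex.I)‖ ≤ 5 + 4 * |y| := by
  have h := norm_riemannZeta_sub_le (N := 1) le_rfl (s := 1 / 2 + y * Complex.I) (by simp)
  have h1 := norm_half_add_le y
  have h2 := half_le_norm_half_add_sub_one y
  have h3 : ‖(1 : ℂ) + 1 / (1 / 2 + y * Complex.I - 1)‖ ≤ 3 := by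
    refine (norm_add_le _ _).trans ?_
    rw [norm_div, norm_one]
    have : 1 / ‖(1 / 2 + y * Complex.I - 1 : ℂ)‖ ≤ 2 := by
      rw [div_le_iff₀ (by linarith)]; linarith
    linarith
  simp only [Finset.range_one, Finset.sum_singleton, Nat.cast_zero, zero_add, Complex.one_cpow,
    Nat.cast_one, Real.sqrt_one, div_one] at h
  have h4 := norm_le_norm_add_norm_sub' (riemannZeta (1 / 2 + y * Complex.I))
    ((1 : ℂ) + 1 / (1 / 2 + y * Complex.I - 1))
  linarith

theorem norm_riemannZeta_half_le_sqrt {y : ℝ} (hy : 1 ≤ y) :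
    ‖riemannZeta (1 / 2 + y * Complex.I)‖ ≤ 12 * Real.sqrt y := by
  -- the length `N ≈ y` balances the partial sum `√N` and the remainder `y / √N`
  set N : ℕ := ⌈y⌉₊ with hNdef
  have hN1 : 1 ≤ N := Nat.one_le_ceil_iff.2 (by linarith)
  have hyN : y ≤ N := Nat.le_ceil y
  have hN2 : (N : ℝ) ≤ 2 * y := by
    have := Nat.ceil_lt_add_one (by linarith : 0 ≤ y)
    linarith
  set s : ℂ := 1 / 2 + y * Complex.I with hs
  have hsre : s.re = 1 / 2 := by simp [hs]
  have h := norm_riemannZeta_sub_le hN1 hsre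
  set a := Real.sqrt y with ha
  set b := Real.sqrt N with hb
  have haa : a * a = y := Real.mul_self_sqrt (by linarith)
  have ha1 : 1 ≤ a := Real.one_le_sqrt.2 hy
  have hab : a ≤ b := Real.sqrt_le_sqrt hyN
  have hbb : b * b = N := Real.mul_self_sqrt (by linarith)
  have hba : b ≤ 3 / 2 * a := by
    refine abs_le_of_sq_le_sq' ?_ (by positivity) |>.2
    nlinarith
  have h1 : ‖s‖ ≤ 3 / 2 * y := by
    have := norm_half_add_le y
    rw [abs_of_nonneg (by linarith)] at this
    linarith
  have h2 : y ≤ ‖s - 1‖ := (le_abs_self y).trans (abs_le_norm_half_add_sub_one y)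
  have h3 : ‖∑ k ∈ Finset.range N, ((k : ℂ) + 1) ^ (-s)‖ ≤ 2 * b := by
    refine (norm_sum_le _ _).trans (le_trans (le_of_eq ?_) (sum_range_one_div_sqrt_le N))
    refine Finset.sum_congr rfl fun k _ => ?_
    have hk : (0 : ℝ) < (k : ℝ) + 1 := by positivity
    have : ((k : ℂ) + 1) = (((k : ℝ) + 1 : ℝ) : ℂ) := by push_cast; rfl
    rw [this, Complex.norm_cpow_eq_rpow_re_of_pos hk, Complex.neg_re, hsre, Real.rpow_neg hk.le,
      ← Real.sqrt_eq_rpow, one_div]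
  have h4 : ‖(N : ℂ) ^ (1 - s) / (s - 1)‖ ≤ 3 / 2 := by
    rw [norm_div, Complex.norm_natCast_cpow_of_pos (by omega), Complex.sub_re, hsre,
      Complex.one_re, show (1 : ℝ) - 1 / 2 = 1 / 2 by norm_num, ← Real.sqrt_eq_rpow,
      div_le_iff₀ (by linarith)]
    refine hba.trans ?_
    nlinarith
  have h5 : 4 * ‖s‖ / b ≤ 6 * a := by
    rw [div_le_iff₀ (by linarith)]
    nlinarith
  have h6 := norm_le_norm_add_norm_sub' (riemannZeta s)
    (∑ k ∈ Finset.range N, ((k : ℂ) + 1) ^ (-s) + (N : ℂ) ^ (1 - s) / (s - 1))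
  have h7 := norm_add_le (∑ k ∈ Finset.range N, ((k : ℂ) + 1) ^ (-s)) ((N : ℂ) ^ (1 - s) / (s - 1))
  nlinarith

/-- `ζ(1/2 + iy)` as `1` plus a sum over `n ≥ 2` and an integral over `w ≥ log 2` (that of
`x ^ (-s)`, with `x = exp w`), all of whose terms oscillate in `y`. The pole term
`N ^ (1 - s) / (s - 1)`, which is large, is traded for the integral and the small term
`2 ^ (1 - s) / (s - 1)`. -/
theorem norm_riemannZeta_sub_expansion_le {N : ℕ} (hN : 1 ≤ N) {y : ℝ} (hy : 0 < y) :
    ‖riemannZeta (1 / 2 + y * Complex.I) - (1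
      + ∑ k ∈ Finset.range (N - 1), ((k : ℂ) + 2) ^ (-(1 / 2 + y * Complex.I))
      - ∫ w in (Real.log 2)..(Real.log N), Complex.exp ((1 / 2 - y * Complex.I) * w))‖
      ≤ 4 * (1 / 2 + y) / Real.sqrt N + 2 / y := by
  set s : ℂ := 1 / 2 + y * Complex.I with hs
  have hsre : s.re = 1 / 2 := by simp [hs]
  have hN0 : (0 : ℝ) < N := by exact_mod_cast hN
  have h := norm_riemannZeta_sub_le hN hsre
  have h1 : ‖s‖ ≤ 1 / 2 + y := by
    have := norm_half_add_le y
    rwa [abs_of_pos hy] at this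
  have h2 : y ≤ ‖s - 1‖ := (le_abs_self y).trans (abs_le_norm_half_add_sub_one y)
  have hs1 : s - 1 ≠ 0 := norm_pos_iff.1 (by linarith)
  have hs1' : 1 - s ≠ 0 := by rw [← neg_sub]; exact neg_ne_zero.2 hs1
  have hhalf : 1 / 2 - y * Complex.I = 1 - s := by rw [hs]; ring
  have hexp : ∀ x : ℝ, 0 < x → Complex.exp ((1 - s) * (Real.log x : ℝ)) = (x : ℂ) ^ (1 - s) := by
    intro x hx
    rw [Complex.cpow_def_of_ne_zero (by exact_mod_cast hx.ne'), Complex.ofReal_log hx.le, mul_comm]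
  have hint := integral_exp_mul_complex (a := Real.log 2) (b := Real.log N) hs1'
  rw [hexp 2 (by norm_num), hexp N hN0] at hint
  have hsum : ∑ k ∈ Finset.range N, ((k : ℂ) + 1) ^ (-s) =
      1 + ∑ k ∈ Finset.range (N - 1), ((k : ℂ) + 2) ^ (-s) := by
    obtain ⟨M, rfl⟩ : ∃ M, N = M + 1 := ⟨N - 1, by omega⟩
    rw [Finset.sum_range_succ', add_comm]
    simp only [Nat.cast_zero, zero_add, Complex.one_cpow, Nat.add_sub_cancel]
    congr 1
    refine Finset.sum_congr rfl fun k _ => ?_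
    push_cast
    ring_nf
  have h3 : ‖(2 : ℂ) ^ (1 - s) / (s - 1)‖ ≤ 2 / y := by
    rw [norm_div]
    have : ‖(2 : ℂ) ^ (1 - s)‖ ≤ 2 := by
      rw [show (2 : ℂ) = ((2 : ℝ) : ℂ) by norm_num,
        Complex.norm_cpow_eq_rpow_re_of_pos (by norm_num), Complex.sub_re, hsre]
      calc (2 : ℝ) ^ ((1 : ℂ).re - 1 / 2) ≤ 2 ^ (1 : ℝ) :=
            Real.rpow_le_rpow_of_exponent_le (by norm_num) (by norm_num)
        _ = 2 := Real.rpow_one 2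
    exact div_le_div₀ (by norm_num) this hy h2
  have hsplit : riemannZeta s - (1 + ∑ k ∈ Finset.range (N - 1), ((k : ℂ) + 2) ^ (-s)
      - ∫ w in (Real.log 2)..(Real.log N), Complex.exp ((1 - s) * w)) =
      (riemannZeta s - (∑ k ∈ Finset.range N, ((k : ℂ) + 1) ^ (-s) + (N : ℂ) ^ (1 - s) / (s - 1)))
      + (2 : ℂ) ^ (1 - s) / (s - 1) := by
    rw [hint, hsum]
    push_cast
    field_simp
    ring
  rw [hhalf, hsplit]
  refine (norm_add_le _ _).trans (add_le_add (h.trans ?_) h3)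
  gcongr

/-! ### Gaussian averages of `ζ` -/

theorem neg_sq_div_eq (V u : ℝ) : -u ^ 2 / V ^ 2 = -(1 / V ^ 2) * u ^ 2 := by ring

theorem integrable_gauss {V : ℝ} (hV : 0 < V) :
    Integrable fun u : ℝ => Real.exp (-u ^ 2 / V ^ 2) := by
  simp_rw [neg_sq_div_eq]
  exact integrable_exp_neg_mul_sq (by positivity)

theorem integral_gauss {V : ℝ} (hV : 0 < V) :
    ∫ u : ℝ, Real.exp (-u ^ 2 / V ^ 2) = Real.sqrt Real.pi * V := by
  simp_rw [neg_sq_div_eq]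
  rw [integral_gaussian, div_div_eq_mul_div, div_one, Real.sqrt_mul Real.pi_pos.le,
    Real.sqrt_sq hV.le]

theorem sqrt_pi_le_two : Real.sqrt Real.pi ≤ 2 := by
  rw [Real.sqrt_le_left (by norm_num)]
  linarith [Real.pi_le_four]

theorem intervalIntegral_gauss_le {V : ℝ} (hV : 0 < V) {H : ℝ} (hH : 0 ≤ H) :
    ∫ u in (-H)..H, Real.exp (-u ^ 2 / V ^ 2) ≤ 2 * V := by
  rw [intervalIntegral.integral_of_le (by linarith)]
  calc ∫ u in Set.Ioc (-H) H, Real.exp (-u ^ 2 / V ^ 2)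
      ≤ ∫ u, Real.exp (-u ^ 2 / V ^ 2) :=
        setIntegral_le_integral (integrable_gauss hV)
          (Filter.Eventually.of_forall fun u => (Real.exp_pos _).le)
    _ = Real.sqrt Real.pi * V := integral_gauss hV
    _ ≤ 2 * V := mul_le_mul_of_nonneg_right sqrt_pi_le_two hV.le

theorem integral_gauss_mul_exp {V : ℝ} (hV : 0 < V) (ξ : ℝ) :
    ∫ u : ℝ, (Real.exp (-u ^ 2 / V ^ 2) : ℂ) * Complex.exp (Complex.I * ((ξ * u : ℝ) : ℂ)) =
      ((Real.sqrt Real.pi * V * Real.exp (-(V ^ 2 * ξ ^ 2) / 4) : ℝ) : ℂ) := by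
  have hb : 0 < ((1 / V ^ 2 : ℝ) : ℂ).re := by rw [Complex.ofReal_re]; positivity
  have h := fourierIntegral_gaussian hb (ξ : ℂ)
  have h1 : ((Real.pi : ℂ) / ((1 / V ^ 2 : ℝ) : ℂ)) ^ (1 / 2 : ℂ) =
      ((Real.sqrt Real.pi * V : ℝ) : ℂ) := by
    rw [← Complex.ofReal_div, show (1 / 2 : ℂ) = ((1 / 2 : ℝ) : ℂ) by norm_num,
      ← Complex.ofReal_cpow (by positivity), ← Real.sqrt_eq_rpow, div_div_eq_mul_div, div_one,
      Real.sqrt_mul Real.pi_pos.le, Real.sqrt_sq hV.le]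
  rw [h1] at h
  rw [Complex.ofReal_mul, Complex.ofReal_exp]
  convert h using 1
  · refine integral_congr_ae (Filter.Eventually.of_forall fun u => ?_)
    simp only
    rw [Complex.ofReal_exp, mul_comm]
    congr 2
    · push_cast; ring
    · push_cast; ring
  · congr 2
    have : (V : ℂ) ≠ 0 := by exact_mod_cast hV.ne'
    push_cast
    field_simp

/-- Truncating the Fourier transform of a Gaussian to `[-H, H]`. -/
theorem norm_intervalIntegral_gauss_mul_exp_sub_le {V : ℝ} (hV : 0 < V) {H : ℝ} (hH : 0 ≤ H)
    (ξ : ℝ) :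
    ‖(∫ u in (-H)..H, (Real.exp (-u ^ 2 / V ^ 2) : ℂ) * Complex.exp (Complex.I * ((ξ * u : ℝ) : ℂ)))
      - ((Real.sqrt Real.pi * V * Real.exp (-(V ^ 2 * ξ ^ 2) / 4) : ℝ) : ℂ)‖
      ≤ 3 * V * Real.exp (-H ^ 2 / (2 * V ^ 2)) := by
  set F : ℝ → ℂ := fun u => (Real.exp (-u ^ 2 / V ^ 2) : ℂ)
    * Complex.exp (Complex.I * ((ξ * u : ℝ) : ℂ)) with hF
  have hFn : ∀ u, ‖F u‖ = Real.exp (-u ^ 2 / V ^ 2) := fun u => by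
    rw [hF]
    simp only
    rw [norm_mul, mul_comm Complex.I, Complex.norm_exp_ofReal_mul_I, mul_one, Complex.norm_real,
      Real.norm_of_nonneg (Real.exp_pos _).le]
  have hFi : Integrable F := by
    refine (integrable_gauss hV).mono' ?_ (Filter.Eventually.of_forall fun u => (hFn u).le)
    have : Continuous F := by rw [hF]; fun_prop
    exact this.aestronglyMeasurable
  have hsplit := integral_add_compl (μ := volume) (measurableSet_Ioc (a := -H) (b := H)) hFi
  rw [intervalIntegral.integral_of_le (by linarith), ← integral_gauss_mul_exp hV ξ, ← hsplit,
    sub_add_cancel_left, norm_neg]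
  have hW : 0 < Real.sqrt 2 * V := by positivity
  have hg := integrable_gauss hW
  have hWsq : (Real.sqrt 2 * V) ^ 2 = 2 * V ^ 2 := by rw [mul_pow]; norm_num
  calc ‖∫ u in (Set.Ioc (-H) H)ᶜ, F u‖
      ≤ ∫ u in (Set.Ioc (-H) H)ᶜ, Real.exp (-H ^ 2 / (2 * V ^ 2))
          * Real.exp (-u ^ 2 / (Real.sqrt 2 * V) ^ 2) := by
        refine norm_integral_le_of_norm_le (hg.const_mul _).integrableOn ?_
        refine (ae_restrict_iff' measurableSet_Ioc.compl).2
          (Filter.Eventually.of_forall fun u hu => ?_)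
        rw [hFn, ← Real.exp_add, hWsq]
        refine Real.exp_le_exp.2 ?_
        have h2 : H ^ 2 ≤ u ^ 2 := by
          rw [Set.mem_compl_iff, Set.mem_Ioc, not_and_or, not_lt, not_le] at hu
          rcases hu with h | h <;> nlinarith
        rw [← add_div, div_le_div_iff₀ (by positivity) (by positivity)]
        nlinarith [mul_le_mul_of_nonneg_right h2 (sq_nonneg V)]
    _ ≤ ∫ u, Real.exp (-H ^ 2 / (2 * V ^ 2)) * Real.exp (-u ^ 2 / (Real.sqrt 2 * V) ^ 2) :=
        setIntegral_le_integral (hg.const_mul _)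
          (Filter.Eventually.of_forall fun u => by positivity)
    _ = Real.exp (-H ^ 2 / (2 * V ^ 2)) * (Real.sqrt Real.pi * (Real.sqrt 2 * V)) := by
        rw [integral_const_mul, integral_gauss hW]
    _ ≤ 3 * V * Real.exp (-H ^ 2 / (2 * V ^ 2)) := by
        have h3 : Real.sqrt Real.pi * Real.sqrt 2 ≤ 3 := by
          rw [← Real.sqrt_mul Real.pi_pos.le, Real.sqrt_le_left (by norm_num)]
          linarith [Real.pi_le_four]
        have h4 : 0 < Real.exp (-H ^ 2 / (2 * V ^ 2)) * V := by positivity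
        nlinarith

/-- Each oscillating term of the expansion of `ζ` integrates to almost nothing against the
Gaussian: its frequency `w - η ≥ log 2 - 1/4` is bounded away from `0`. -/
theorem norm_intervalIntegral_gauss_mul_exp_le {V : ℝ} (hV : 0 < V) {H : ℝ} (hH : 0 ≤ H)
    {η w : ℝ} (hη : |η| ≤ 1 / 4) (hw : Real.log 2 ≤ w) :
    ‖∫ u in (-H)..H, (Real.exp (-u ^ 2 / V ^ 2) : ℂ)
      * Complex.exp (Complex.I * (((η - w) * u : ℝ) : ℂ))‖
      ≤ 3 * V * (Real.exp (-V ^ 2 / 25) + Real.exp (-H ^ 2 / (2 * V ^ 2))) := by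
  have h := norm_intervalIntegral_gauss_mul_exp_sub_le hV hH (η - w)
  have hmain : ‖((Real.sqrt Real.pi * V * Real.exp (-(V ^ 2 * (η - w) ^ 2) / 4) : ℝ) : ℂ)‖
      ≤ 3 * V * Real.exp (-V ^ 2 / 25) := by
    rw [Complex.norm_real, Real.norm_of_nonneg (by positivity)]
    have hexp : Real.exp (-(V ^ 2 * (η - w) ^ 2) / 4) ≤ Real.exp (-V ^ 2 / 25) := by
      refine Real.exp_le_exp.2 ?_
      have h1 : 4 / 10 ≤ w - η := by
        have := Real.log_two_gt_d9
        linarith [(abs_le.1 hη).2]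
      have h2 : 4 / 25 ≤ (η - w) ^ 2 := by nlinarith
      nlinarith [mul_le_mul_of_nonneg_left h2 (sq_nonneg V)]
    have := sqrt_pi_le_two
    gcongr
    linarith
  have := norm_le_norm_add_norm_sub' (∫ u in (-H)..H, (Real.exp (-u ^ 2 / V ^ 2) : ℂ)
      * Complex.exp (Complex.I * (((η - w) * u : ℝ) : ℂ)))
      ((Real.sqrt Real.pi * V * Real.exp (-(V ^ 2 * (η - w) ^ 2) / 4) : ℝ) : ℂ)
  linarith

theorem continuous_riemannZeta_half :
    Continuous fun y : ℝ => riemannZeta (1 / 2 + y * Complex.I) := by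
  rw [continuous_iff_continuousAt]
  intro y
  have h1 : (1 / 2 + y * Complex.I : ℂ) ≠ 1 := fun h => by
    have := congrArg Complex.re h
    norm_num at this
  exact ContinuousAt.comp (f := fun y : ℝ => (1 / 2 + y * Complex.I : ℂ))
    (differentiableAt_riemannZeta h1).continuousAt (by fun_prop)

/-- The Gaussian average of `ζ(1/2 + iy)` around `y₀`, twisted by a small frequency `η`, is that of
the constant `1`. -/
theorem norm_intervalIntegral_gauss_mul_zeta_sub_le {V : ℝ} (hV : 0 < V) {H : ℝ} (hH : 0 ≤ H)
    {η : ℝ} (hη : |η| ≤ 1 / 4) {y₀ Y Y' : ℝ} (hY : 0 < Y) (hYy : Y ≤ y₀ - H) (hYy' : y₀ + H ≤ Y')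
    {N : ℕ} (hN : 2 ≤ N) :
    ‖(∫ u in (-H)..H, (Real.exp (-u ^ 2 / V ^ 2) : ℂ) * Complex.exp (Complex.I * ((η * u : ℝ) : ℂ))
        * riemannZeta (1 / 2 + ((y₀ + u : ℝ) : ℂ) * Complex.I))
      - ((Real.sqrt Real.pi * V * Real.exp (-(V ^ 2 * η ^ 2) / 4) : ℝ) : ℂ)‖
      ≤ 3 * V * Real.exp (-H ^ 2 / (2 * V ^ 2))
        + 2 * N ^ 2 * (3 * V * (Real.exp (-V ^ 2 / 25) + Real.exp (-H ^ 2 / (2 * V ^ 2))))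
        + 2 * V * (4 * (1 / 2 + Y') / Real.sqrt N + 2 / Y) := by
  set D : ℝ := 3 * V * (Real.exp (-V ^ 2 / 25) + Real.exp (-H ^ 2 / (2 * V ^ 2))) with hD
  have hD0 : 0 ≤ D := by positivity
  have hN2 : (2 : ℝ) ≤ N := by exact_mod_cast hN
  set E : ℝ → ℂ := fun u => (Real.exp (-u ^ 2 / V ^ 2) : ℂ)
    * Complex.exp (Complex.I * ((η * u : ℝ) : ℂ)) with hE
  have hEc : Continuous E := by rw [hE]; fun_prop
  have hEn : ∀ u, ‖E u‖ = Real.exp (-u ^ 2 / V ^ 2) := fun u => by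
    rw [hE]
    simp only
    rw [norm_mul, mul_comm Complex.I, Complex.norm_exp_ofReal_mul_I, mul_one, Complex.norm_real,
      Real.norm_of_nonneg (Real.exp_pos _).le]
  have hosc : ∀ w : ℝ, Real.log 2 ≤ w →
      ‖∫ u in (-H)..H, E u * Complex.exp (Complex.I * ((-(w * u) : ℝ) : ℂ))‖ ≤ D := by
    intro w hw
    refine le_trans (le_of_eq ?_) (norm_intervalIntegral_gauss_mul_exp_le hV hH hη hw)
    congr 1
    refine intervalIntegral.integral_congr fun u _ => ?_
    simp only [hE]
    rw [mul_assoc, ← Complex.exp_add]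
    congr 2
    push_cast; ring
  set S : ℝ → ℂ := fun u => ∑ k ∈ Finset.range (N - 1),
    ((k : ℂ) + 2) ^ (-(1 / 2 + ((y₀ + u : ℝ) : ℂ) * Complex.I)) with hS
  set J : ℝ → ℂ := fun u => ∫ w in (Real.log 2)..(Real.log N),
    Complex.exp ((1 / 2 - ((y₀ + u : ℝ) : ℂ) * Complex.I) * w) with hJ
  have hSterm : ∀ (k : ℕ) (u : ℝ), ((k : ℂ) + 2) ^ (-(1 / 2 + ((y₀ + u : ℝ) : ℂ) * Complex.I)) =
      ((k : ℂ) + 2) ^ (-(1 / 2 + (y₀ : ℂ) * Complex.I))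
        * Complex.exp (Complex.I * ((-(Real.log ((k : ℝ) + 2) * u) : ℝ) : ℂ)) := by
    intro k u
    have hk : (0 : ℝ) < (k : ℝ) + 2 := by positivity
    have hkc : ((k : ℂ) + 2) ≠ 0 := by exact_mod_cast hk.ne'
    have hl : Complex.log ((k : ℂ) + 2) = ((Real.log ((k : ℝ) + 2) : ℝ) : ℂ) := by
      rw [Complex.ofReal_log hk.le]; push_cast; rfl
    rw [Complex.cpow_def_of_ne_zero hkc, Complex.cpow_def_of_ne_zero hkc, ← Complex.exp_add, hl]
    congr 1
    push_cast; ring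
  have hScont : Continuous S := by
    rw [hS]
    refine continuous_finsetSum _ fun k _ => ?_
    simp_rw [hSterm k]
    fun_prop
  have hJjoint : Continuous (Function.uncurry fun (u w : ℝ) =>
      Complex.exp ((1 / 2 - ((y₀ + u : ℝ) : ℂ) * Complex.I) * w)) := by
    unfold Function.uncurry
    fun_prop
  have hJcont : Continuous J :=
    intervalIntegral.continuous_parametric_intervalIntegral_of_continuous' hJjoint _ _
  -- the sum over `n ≥ 2`
  have hSbound : ‖∫ u in (-H)..H, E u * S u‖ ≤ N * D := by
    have h1 : ∫ u in (-H)..H, E u * S u = ∑ k ∈ Finset.range (N - 1),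
        ((k : ℂ) + 2) ^ (-(1 / 2 + (y₀ : ℂ) * Complex.I)) * ∫ u in (-H)..H,
          E u * Complex.exp (Complex.I * ((-(Real.log ((k : ℝ) + 2) * u) : ℝ) : ℂ)) := by
      simp_rw [hS, Finset.mul_sum]
      rw [intervalIntegral.integral_finsetSum]
      · refine Finset.sum_congr rfl fun k _ => ?_
        rw [← intervalIntegral.integral_const_mul]
        refine intervalIntegral.integral_congr fun u _ => ?_
        rw [hSterm]; ring
      · intro k _
        simp_rw [hSterm k]
        exact Continuous.intervalIntegrable (by fun_prop) _ _
    rw [h1]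
    refine (norm_sum_le _ _).trans ((Finset.sum_le_card_nsmul _ _ D fun k _ => ?_).trans ?_)
    · have hk : (0 : ℝ) < (k : ℝ) + 2 := by positivity
      have hk1 : (1 : ℝ) ≤ (k : ℝ) + 2 := by linarith [(k.cast_nonneg : (0 : ℝ) ≤ k)]
      rw [norm_mul]
      have h2 : ‖((k : ℂ) + 2) ^ (-(1 / 2 + (y₀ : ℂ) * Complex.I))‖ ≤ 1 := by
        rw [show ((k : ℂ) + 2) = (((k : ℝ) + 2 : ℝ) : ℂ) by push_cast; rfl,
          Complex.norm_cpow_eq_rpow_re_of_pos hk]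
        exact Real.rpow_le_one_of_one_le_of_nonpos hk1 (by simp)
      have h3 := hosc (Real.log ((k : ℝ) + 2))
        (Real.log_le_log (by norm_num) (by linarith [(k.cast_nonneg : (0 : ℝ) ≤ k)]))
      calc _ ≤ 1 * D := mul_le_mul h2 h3 (norm_nonneg _) zero_le_one
        _ = D := one_mul D
    · rw [Finset.card_range, nsmul_eq_mul]
      refine mul_le_mul_of_nonneg_right ?_ hD0
      exact_mod_cast Nat.sub_le N 1
  -- the integral over `w ≥ log 2`
  have hlog2 : Real.log 2 ≤ Real.log N := Real.log_le_log (by norm_num) hN2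
  have hJbound : ‖∫ u in (-H)..H, E u * J u‖ ≤ N ^ 2 * D := by
    have h1 : ∫ u in (-H)..H, E u * J u = ∫ w in (Real.log 2)..(Real.log N),
        Complex.exp ((1 / 2 - (y₀ : ℂ) * Complex.I) * w) * ∫ u in (-H)..H,
          E u * Complex.exp (Complex.I * ((-(w * u) : ℝ) : ℂ)) := by
      simp_rw [hJ, ← intervalIntegral.integral_const_mul]
      rw [intervalIntegral_intervalIntegral_swap]
      · refine intervalIntegral.integral_congr fun w _ => ?_
        refine intervalIntegral.integral_congr fun u _ => ?_
        rw [mul_left_comm, ← Complex.exp_add]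
        congr 2
        push_cast; ring
      · have hc : Continuous (Function.uncurry fun (u w : ℝ) =>
            E u * Complex.exp ((1 / 2 - ((y₀ + u : ℝ) : ℂ) * Complex.I) * w)) := by
          unfold Function.uncurry
          fun_prop
        exact (hc.continuousOn.integrableOn_compact
          (isCompact_uIcc.prod isCompact_uIcc)).mono_set
          (Set.prod_mono Set.uIoc_subset_uIcc Set.uIoc_subset_uIcc)
    rw [h1]
    have h2 : ∀ w ∈ Set.uIoc (Real.log 2) (Real.log N),
        ‖Complex.exp ((1 / 2 - (y₀ : ℂ) * Complex.I) * w) * ∫ u in (-H)..H,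
          E u * Complex.exp (Complex.I * ((-(w * u) : ℝ) : ℂ))‖ ≤ N * D := by
      intro w hw
      rw [Set.uIoc_of_le hlog2] at hw
      have hw0 : 0 ≤ w := (Real.log_nonneg (by norm_num)).trans hw.1.le
      rw [norm_mul]
      refine mul_le_mul ?_ (hosc w hw.1.le) (norm_nonneg _) (by positivity)
      rw [Complex.norm_exp]
      have hre : ((1 / 2 - (y₀ : ℂ) * Complex.I) * w).re = w / 2 := by
        simp; ring
      rw [hre]
      calc Real.exp (w / 2) ≤ Real.exp (Real.log N) := Real.exp_le_exp.2 (by linarith [hw.2])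
        _ = N := Real.exp_log (by linarith)
    refine (intervalIntegral.norm_integral_le_of_norm_le_const h2).trans ?_
    have h3 : |Real.log N - Real.log 2| ≤ N := by
      rw [abs_of_nonneg (by linarith)]
      have := Real.log_le_sub_one_of_pos (by linarith : (0 : ℝ) < N)
      have := Real.log_nonneg (by norm_num : (1 : ℝ) ≤ 2)
      linarith
    calc N * D * |Real.log N - Real.log 2| ≤ N * D * N :=
          mul_le_mul_of_nonneg_left h3 (by positivity)
      _ = N ^ 2 * D := by ring
  -- the remainder
  set Q : ℝ → ℂ := fun u => riemannZeta (1 / 2 + ((y₀ + u : ℝ) : ℂ) * Complex.I) - (1 + S u - J u)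
    with hQ
  have hζc : Continuous fun u : ℝ => riemannZeta (1 / 2 + ((y₀ + u : ℝ) : ℂ) * Complex.I) :=
    continuous_riemannZeta_half.comp (by fun_prop : Continuous fun u : ℝ => y₀ + u)
  have hQc : Continuous Q := by rw [hQ]; fun_prop
  set B : ℝ := 4 * (1 / 2 + Y') / Real.sqrt N + 2 / Y with hB
  have hB0 : 0 ≤ B := by
    have : 0 ≤ 1 / 2 + Y' := by linarith
    positivity
  have hQbound : ‖∫ u in (-H)..H, E u * Q u‖ ≤ 2 * V * B := by
    have hle : ‖∫ u in (-H)..H, E u * Q u‖ ≤ ∫ u in (-H)..H, Real.exp (-u ^ 2 / V ^ 2) * B := by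
      refine intervalIntegral.norm_integral_le_of_norm_le (by linarith) ?_
        (Continuous.intervalIntegrable (by fun_prop) _ _)
      refine Filter.Eventually.of_forall fun u hu => ?_
      rw [norm_mul, hEn]
      refine mul_le_mul_of_nonneg_left ?_ (Real.exp_pos _).le
      have hy1 : Y ≤ y₀ + u := by linarith [hu.1]
      have hy2 : y₀ + u ≤ Y' := by linarith [hu.2]
      refine (norm_riemannZeta_sub_expansion_le (by omega : 1 ≤ N) (hY.trans_le hy1)).trans ?_
      rw [hB]
      gcongr
    refine hle.trans ?_
    rw [intervalIntegral.integral_mul_const]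
    exact mul_le_mul_of_nonneg_right (intervalIntegral_gauss_le hV hH) hB0
  have hsplit : (∫ u in (-H)..H, E u * riemannZeta (1 / 2 + ((y₀ + u : ℝ) : ℂ) * Complex.I)) =
      (∫ u in (-H)..H, E u) + (∫ u in (-H)..H, E u * S u) - (∫ u in (-H)..H, E u * J u)
        + ∫ u in (-H)..H, E u * Q u := by
    have i1 : IntervalIntegrable E volume (-H) H := hEc.intervalIntegrable _ _
    have i2 : IntervalIntegrable (fun u => E u * S u) volume (-H) H :=
      (hEc.mul hScont).intervalIntegrable _ _
    have i3 : IntervalIntegrable (fun u => E u * J u) volume (-H) H :=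
      (hEc.mul hJcont).intervalIntegrable _ _
    have i4 : IntervalIntegrable (fun u => E u * Q u) volume (-H) H :=
      (hEc.mul hQc).intervalIntegrable _ _
    rw [← intervalIntegral.integral_add i1 i2, ← intervalIntegral.integral_sub (i1.add i2) i3,
      ← intervalIntegral.integral_add ((i1.add i2).sub i3) i4]
    refine intervalIntegral.integral_congr fun u _ => ?_
    simp only [hQ]
    ring
  have hmain := norm_intervalIntegral_gauss_mul_exp_sub_le hV hH η
  rw [hsplit]
  set m : ℂ := ((Real.sqrt Real.pi * V * Real.exp (-(V ^ 2 * η ^ 2) / 4) : ℝ) : ℂ)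
  have hfin : (∫ u in (-H)..H, E u) + (∫ u in (-H)..H, E u * S u) - (∫ u in (-H)..H, E u * J u)
        + (∫ u in (-H)..H, E u * Q u) - m = ((∫ u in (-H)..H, E u) - m)
        + (∫ u in (-H)..H, E u * S u) - (∫ u in (-H)..H, E u * J u)
        + ∫ u in (-H)..H, E u * Q u := by ring
  rw [hfin]
  have t1 := norm_add_le (((∫ u in (-H)..H, E u) - m) + (∫ u in (-H)..H, E u * S u)
    - (∫ u in (-H)..H, E u * J u)) (∫ u in (-H)..H, E u * Q u)
  have t2 := norm_sub_le (((∫ u in (-H)..H, E u) - m) + (∫ u in (-H)..H, E u * S u))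
    (∫ u in (-H)..H, E u * J u)
  have t3 := norm_add_le ((∫ u in (-H)..H, E u) - m) (∫ u in (-H)..H, E u * S u)
  have hNN : (N : ℝ) * D ≤ N ^ 2 * D := by
    refine mul_le_mul_of_nonneg_right ?_ hD0
    nlinarith
  linarith

/-! ### Gaussian averages of Hardy's function -/

theorem norm_chiInvSqrt (t : ℝ) : ‖chiInvSqrt t‖ = 1 := by
  have h : ‖Complex.Gammaℝ (1 / 2 + t * Complex.I)‖ ≠ 0 :=
    norm_ne_zero_iff.2 (gammaR_half_ne_zero t)
  rw [chiInvSqrt, norm_div, Complex.norm_real, norm_norm, div_self h]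

theorem abs_hardyZ_le (t : ℝ) : |hardyZ t| ≤ 5 + 4 * |t| := by
  have h : |hardyZ t| = ‖(hardyZ t : ℂ)‖ := by rw [Complex.norm_real, Real.norm_eq_abs]
  rw [h, coe_hardyZ, norm_mul, norm_chiInvSqrt, one_mul]
  exact norm_riemannZeta_half_le t

theorem continuous_hardyZ : Continuous hardyZ :=
  Complex.continuous_re.comp (continuous_chiInvSqrt.mul continuous_riemannZeta_half)

/-- The Gaussian of width `V`, rotated by the second order Taylor polynomial of minus the phase
`θ(T + u)`, without its constant term. -/
def rotatedGauss (T V u : ℝ) : ℂ := (Real.exp (-u ^ 2 / V ^ 2) : ℂ) * Complex.exp (Complex.I *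
  ((-(u * Real.log (Real.sqrt (T / (2 * Real.pi))) + u ^ 2 / (4 * T)) : ℝ) : ℂ))

theorem continuous_rotatedGauss (T V : ℝ) : Continuous (rotatedGauss T V) := by
  unfold rotatedGauss; fun_prop

theorem norm_rotatedGauss (T V u : ℝ) : ‖rotatedGauss T V u‖ = Real.exp (-u ^ 2 / V ^ 2) := by
  rw [rotatedGauss, norm_mul, mul_comm Complex.I, Complex.norm_exp_ofReal_mul_I, mul_one,
    Complex.norm_real, Real.norm_of_nonneg (Real.exp_pos _).le]

/-- Near `T = q ^ 12`, the phase of `Z` may be replaced by its quadratic Taylor polynomial. -/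
theorem norm_hardyZ_sub_le {q v : ℝ} (hq : 2 ≤ q) (hv : |v| ≤ q ^ 5) :
    ‖(hardyZ (q ^ 12 + v) : ℂ) - Complex.exp (Complex.I * ((thetaMain (q ^ 12)
      + v * Real.log (Real.sqrt (q ^ 12 / (2 * Real.pi))) + v ^ 2 / (4 * q ^ 12) : ℝ) : ℂ))
      * riemannZeta (1 / 2 + ((q ^ 12 + v : ℝ) : ℂ) * Complex.I)‖ ≤ 840 / q ^ 3 := by
  have hq0 : 0 < q := by linarith
  have hT : 0 < q ^ 12 := by positivity
  have hq7 : (2 : ℝ) ^ 7 ≤ q ^ 7 := pow_le_pow_left₀ (by norm_num) hq 7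
  have hq5 : (2 : ℝ) ^ 5 ≤ q ^ 5 := pow_le_pow_left₀ (by norm_num) hq 5
  have hq12 : q ^ 12 = q ^ 5 * q ^ 7 := by ring
  have hvT : q ^ 5 ≤ q ^ 12 / 2 := by rw [hq12]; nlinarith
  obtain ⟨hv1, hv2⟩ := abs_le.1 hv
  set y := q ^ 12 + v with hy
  have hy1 : q ^ 12 / 2 ≤ y := by linarith
  have hy2 : y ≤ 2 * q ^ 12 := by linarith
  have hy4 : 4 ≤ y := by nlinarith
  have hζ : ‖riemannZeta (1 / 2 + (y : ℂ) * Complex.I)‖ ≤ 24 * q ^ 6 := by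
    refine (norm_riemannZeta_half_le_sqrt (by linarith)).trans ?_
    have : Real.sqrt y ≤ 2 * q ^ 6 := by
      rw [Real.sqrt_le_left (by positivity)]
      nlinarith
    linarith
  have h1 := norm_chiInvSqrt_sub_le hy4
  have h2 := norm_exp_I_mul_sub_exp_I_mul_le (thetaMain y) (thetaMain (q ^ 12)
      + v * Real.log (Real.sqrt (q ^ 12 / (2 * Real.pi))) + v ^ 2 / (4 * q ^ 12))
  have h3 := abs_thetaMain_add_sub_le hT (hv.trans hvT)
  have h4 : 17 / y ≤ 34 / q ^ 9 := by
    rw [div_le_div_iff₀ (by linarith) (by positivity)]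
    have : q ^ 12 = q ^ 9 * q ^ 3 := by ring
    have hq3 : (2 : ℝ) ^ 3 ≤ q ^ 3 := pow_le_pow_left₀ (by norm_num) hq 3
    nlinarith [pow_pos hq0 9]
  have h5 : |v| ^ 3 / (q ^ 12) ^ 2 ≤ 1 / q ^ 9 := by
    rw [div_le_div_iff₀ (by positivity) (by positivity)]
    calc |v| ^ 3 * q ^ 9 ≤ (q ^ 5) ^ 3 * q ^ 9 := by gcongr
      _ = 1 * (q ^ 12) ^ 2 := by ring
  set φ : ℝ := thetaMain (q ^ 12) + v * Real.log (Real.sqrt (q ^ 12 / (2 * Real.pi)))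
    + v ^ 2 / (4 * q ^ 12) with hφ
  have h6 : ‖chiInvSqrt y - Complex.exp (Complex.I * (φ : ℂ))‖ ≤ 35 / q ^ 9 := by
    have := norm_sub_le_norm_sub_add_norm_sub (chiInvSqrt y)
      (Complex.exp (Complex.I * (thetaMain y : ℝ))) (Complex.exp (Complex.I * (φ : ℂ)))
    have h7 : 35 / q ^ 9 = 34 / q ^ 9 + 1 / q ^ 9 := by ring
    rw [h7]
    linarith
  rw [coe_hardyZ, ← sub_mul, norm_mul]
  calc _ ≤ 35 / q ^ 9 * (24 * q ^ 6) := mul_le_mul h6 hζ (norm_nonneg _) (by positivity)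
    _ = 840 / q ^ 3 := by field_simp; norm_num

/-- The Gaussian average of `ζ(1/2 + iy)` around `T + x`, with the twist by the frequency `x / (2T)`
that comes from the cross term `2ux` of `(u + x)²`, at the scale `T = q ^ 12`. -/
theorem norm_intervalIntegral_gauss_mul_zeta_sub_le_of_abs_le {q V L x : ℝ} (hq : 2 ≤ q)
    (hV : 0 < V) (hVq : V ≤ q ^ 4) (hL : 0 ≤ L) (hLq : L ≤ q / 2)
    (hVexp : Real.exp (-V ^ 2 / 25) ≤ 1 / q ^ 67) (hLexp : Real.exp (-L ^ 2 / 2) ≤ 1 / q ^ 67)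
    (hx : |x| ≤ q ^ 3) :
    ‖(∫ u in (-(V * L))..(V * L), (Real.exp (-u ^ 2 / V ^ 2) : ℂ)
        * Complex.exp (Complex.I * ((x / (2 * q ^ 12) * u : ℝ) : ℂ))
        * riemannZeta (1 / 2 + ((q ^ 12 + x + u : ℝ) : ℂ) * Complex.I))
      - ((Real.sqrt Real.pi * V : ℝ) : ℂ)‖ ≤ 80 * (V / q ^ 3) := by
  have hq0 : 0 < q := by linarith
  have hHV : -(V * L) ^ 2 / (2 * V ^ 2) = -L ^ 2 / 2 := by field_simp
  obtain ⟨H, hH⟩ : ∃ H, H = V * L := ⟨_, rfl⟩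
  obtain ⟨η, hη⟩ : ∃ η, η = x / (2 * q ^ 12) := ⟨_, rfl⟩
  -- `N ≥ q ^ 32` makes the remainder `T / √N` of the expansion at most `q ^ (-4)`, and
  -- `N² V / q ^ 67` is still of the order `V / q ^ 3`
  obtain ⟨N, hN⟩ : ∃ N, N = ⌈q ^ 32⌉₊ := ⟨_, rfl⟩
  have hH0 : 0 ≤ H := by rw [hH]; positivity
  have hHq : H ≤ q ^ 5 / 2 := by
    calc H ≤ q ^ 4 * (q / 2) := by rw [hH]; exact mul_le_mul hVq hLq hL (by positivity)
      _ = q ^ 5 / 2 := by ring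
  have hq9 : (2 : ℝ) ^ 9 ≤ q ^ 9 := pow_le_pow_left₀ (by norm_num) hq 9
  have hq7 : (2 : ℝ) ^ 7 ≤ q ^ 7 := pow_le_pow_left₀ (by norm_num) hq 7
  have hq2 : (2 : ℝ) ^ 2 ≤ q ^ 2 := pow_le_pow_left₀ (by norm_num) hq 2
  have h35 : q ^ 3 ≤ q ^ 5 / 2 := by
    have : q ^ 5 = q ^ 3 * q ^ 2 := by ring
    nlinarith [pow_pos hq0 3]
  have h512 : q ^ 5 ≤ q ^ 12 / 2 := by
    have : q ^ 12 = q ^ 5 * q ^ 7 := by ring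
    nlinarith [pow_pos hq0 5]
  obtain ⟨hx1, hx2⟩ := abs_le.1 hx
  have hηabs : |η| ≤ 1 / (2 * q ^ 9) := by
    rw [hη, abs_div, abs_of_pos (by positivity : 0 < 2 * q ^ 12)]
    calc |x| / (2 * q ^ 12) ≤ q ^ 3 / (2 * q ^ 12) := by gcongr
      _ = 1 / (2 * q ^ 9) := by field_simp
  have hη4 : |η| ≤ 1 / 4 := by
    refine hηabs.trans ?_
    rw [div_le_div_iff₀ (by positivity) (by norm_num)]
    linarith
  have hq32 : (2 : ℝ) ^ 32 ≤ q ^ 32 := pow_le_pow_left₀ (by norm_num) hq 32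
  have hNq : q ^ 32 ≤ (N : ℝ) := by rw [hN]; exact Nat.le_ceil _
  have hNq2 : (N : ℝ) ≤ 2 * q ^ 32 := by
    have := Nat.ceil_lt_add_one (by positivity : 0 ≤ q ^ 32)
    rw [← hN] at this
    linarith
  have hN2 : 2 ≤ N := by
    have : (2 : ℝ) ≤ N := by linarith
    exact_mod_cast this
  have hzeta := norm_intervalIntegral_gauss_mul_zeta_sub_le hV hH0 hη4 (y₀ := q ^ 12 + x)
    (Y := q ^ 12 / 2) (Y' := 2 * q ^ 12) (by positivity) (by linarith) (by linarith) hN2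
  rw [← hη, ← hH]
  rw [hH, hHV, ← hH] at hzeta
  have e1 : 3 * V * Real.exp (-L ^ 2 / 2) ≤ 3 * (V / q ^ 3) := by
    have : 1 / q ^ 67 ≤ 1 / q ^ 3 :=
      one_div_le_one_div_of_le (by positivity) (pow_le_pow_right₀ (by linarith) (by norm_num))
    calc 3 * V * Real.exp (-L ^ 2 / 2) ≤ 3 * V * (1 / q ^ 3) :=
          mul_le_mul_of_nonneg_left (hLexp.trans this) (by positivity)
      _ = 3 * (V / q ^ 3) := by ring
  have e2 : 2 * (N : ℝ) ^ 2 * (3 * V * (Real.exp (-V ^ 2 / 25) + Real.exp (-L ^ 2 / 2)))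
      ≤ 48 * (V / q ^ 3) := by
    calc 2 * (N : ℝ) ^ 2 * (3 * V * (Real.exp (-V ^ 2 / 25) + Real.exp (-L ^ 2 / 2)))
        ≤ 2 * (2 * q ^ 32) ^ 2 * (3 * V * (1 / q ^ 67 + 1 / q ^ 67)) := by gcongr
      _ = 48 * (V / q ^ 3) := by field_simp; ring
  have e3 : 2 * V * (4 * (1 / 2 + 2 * q ^ 12) / Real.sqrt N + 2 / (q ^ 12 / 2))
      ≤ 28 * (V / q ^ 3) := by
    have hs : q ^ 16 ≤ Real.sqrt N := by
      refine Real.le_sqrt_of_sq_le ?_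
      rw [← pow_mul]
      exact hNq
    have f1 : 4 * (1 / 2 + 2 * q ^ 12) / Real.sqrt N ≤ 10 / q ^ 3 := by
      have : 4 * (1 / 2 + 2 * q ^ 12) ≤ 10 * q ^ 12 := by
        have := one_le_pow₀ (by linarith : 1 ≤ q) (n := 12)
        linarith
      calc _ ≤ 10 * q ^ 12 / q ^ 16 := div_le_div₀ (by positivity) this (by positivity) hs
        _ = 10 / q ^ 3 * (1 / q) := by field_simp
        _ ≤ 10 / q ^ 3 * 1 := by
          refine mul_le_mul_of_nonneg_left ?_ (by positivity)
          rw [div_le_one hq0]; linarith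
        _ = 10 / q ^ 3 := mul_one _
    have f3 : 2 / (q ^ 12 / 2) ≤ 4 / q ^ 3 := by
      calc 2 / (q ^ 12 / 2) = 4 / q ^ 3 * (1 / q ^ 9) := by field_simp; norm_num
        _ ≤ 4 / q ^ 3 * 1 := by
          refine mul_le_mul_of_nonneg_left ?_ (by positivity)
          rw [div_le_one (by positivity)]; linarith
        _ = 4 / q ^ 3 := mul_one _
    calc _ ≤ 2 * V * (10 / q ^ 3 + 4 / q ^ 3) :=
          mul_le_mul_of_nonneg_left (add_le_add f1 f3) (by positivity)
      _ = 28 * (V / q ^ 3) := by ring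
  have hpiV0 : 0 ≤ Real.sqrt Real.pi * V := by positivity
  have hgauss : ‖((Real.sqrt Real.pi * V * Real.exp (-(V ^ 2 * η ^ 2) / 4) : ℝ) : ℂ)
      - ((Real.sqrt Real.pi * V : ℝ) : ℂ)‖ ≤ V / q ^ 3 := by
    rw [← Complex.ofReal_sub, Complex.norm_real, Real.norm_eq_abs]
    have h1 : 1 - V ^ 2 * η ^ 2 / 4 ≤ Real.exp (-(V ^ 2 * η ^ 2) / 4) := by
      have := Real.add_one_le_exp (-(V ^ 2 * η ^ 2) / 4)
      linarith
    have h2 : Real.exp (-(V ^ 2 * η ^ 2) / 4) ≤ 1 := by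
      rw [Real.exp_le_one_iff]
      have : 0 ≤ V ^ 2 * η ^ 2 := by positivity
      linarith
    have h3 : V ^ 2 * η ^ 2 / 4 ≤ 1 / (2 * q ^ 3) := by
      have hVη : |V * η| ≤ 1 / (2 * q ^ 5) := by
        rw [abs_mul, abs_of_pos hV]
        calc V * |η| ≤ q ^ 4 * (1 / (2 * q ^ 9)) :=
              mul_le_mul hVq hηabs (abs_nonneg _) (by positivity)
          _ = 1 / (2 * q ^ 5) := by field_simp
      calc V ^ 2 * η ^ 2 / 4 = |V * η| ^ 2 / 4 := by rw [sq_abs]; ring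
        _ ≤ (1 / (2 * q ^ 5)) ^ 2 / 4 :=
          div_le_div_of_nonneg_right (pow_le_pow_left₀ (abs_nonneg _) hVη 2) (by norm_num)
        _ = 1 / (2 * q ^ 3) * (1 / (8 * q ^ 7)) := by field_simp; norm_num
        _ ≤ 1 / (2 * q ^ 3) * 1 := by
          refine mul_le_mul_of_nonneg_left ?_ (by positivity)
          rw [div_le_one (by positivity)]
          linarith
        _ = 1 / (2 * q ^ 3) := mul_one _
    have h4 : Real.sqrt Real.pi * V * Real.exp (-(V ^ 2 * η ^ 2) / 4) - Real.sqrt Real.pi * V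
        = -(Real.sqrt Real.pi * V * (1 - Real.exp (-(V ^ 2 * η ^ 2) / 4))) := by ring
    rw [h4, abs_neg, abs_mul, abs_of_nonneg hpiV0, abs_of_nonneg (by linarith)]
    calc _ ≤ 2 * V * (1 / (2 * q ^ 3)) :=
          mul_le_mul (mul_le_mul_of_nonneg_right sqrt_pi_le_two hV.le) (by linarith) (by linarith)
            (by linarith)
      _ = V / q ^ 3 := by field_simp
  refine (norm_sub_le_norm_sub_add_norm_sub _
    ((Real.sqrt Real.pi * V * Real.exp (-(V ^ 2 * η ^ 2) / 4) : ℝ) : ℂ) _).trans ?_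
  linarith

/-- Under the average over `u`, the phase of `Z(T + u + x)` may be replaced by its quadratic Taylor
polynomial in `u + x`, whose terms in `u` cancel against the rotation, up to the cross term. -/
theorem norm_integral_rotatedGauss_mul_hardyZ_sub_zeta_le {q V H x : ℝ} (hq : 2 ≤ q) (hV : 0 < V)
    (hH0 : 0 ≤ H) (hHx : H + |x| ≤ q ^ 5) :
    ‖(∫ u in (-H)..H, rotatedGauss (q ^ 12) V u * (hardyZ (q ^ 12 + u + x) : ℂ))
      - Complex.exp (Complex.I * ((thetaMain (q ^ 12)
        + x * Real.log (Real.sqrt (q ^ 12 / (2 * Real.pi))) + x ^ 2 / (4 * q ^ 12) : ℝ) : ℂ))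
        * ∫ u in (-H)..H, (Real.exp (-u ^ 2 / V ^ 2) : ℂ)
          * Complex.exp (Complex.I * ((x / (2 * q ^ 12) * u : ℝ) : ℂ))
          * riemannZeta (1 / 2 + ((q ^ 12 + x + u : ℝ) : ℂ) * Complex.I)‖ ≤ 1680 * (V / q ^ 3) := by
  have hq0 : 0 < q := by linarith
  have hZ := fun v => norm_hardyZ_sub_le (v := v) hq
  have hT0 : 0 < q ^ 12 := by positivity
  generalize q ^ 12 = T at *
  generalize hℓ : Real.log (Real.sqrt (T / (2 * Real.pi))) = ℓ at *
  set κ : ℂ := Complex.exp (Complex.I * ((thetaMain T + x * ℓ + x ^ 2 / (4 * T) : ℝ) : ℂ)) with hκ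
  have hζc : Continuous fun u : ℝ => riemannZeta (1 / 2 + ((T + x + u : ℝ) : ℂ) * Complex.I) :=
    continuous_riemannZeta_half.comp (by fun_prop : Continuous fun u : ℝ => T + x + u)
  rw [← intervalIntegral.integral_const_mul, ← intervalIntegral.integral_sub]
  · have hle : ∀ u ∈ Set.Ioc (-H) H, ‖rotatedGauss T V u * (hardyZ (T + u + x) : ℂ)
        - κ * ((Real.exp (-u ^ 2 / V ^ 2) : ℂ)
          * Complex.exp (Complex.I * ((x / (2 * T) * u : ℝ) : ℂ))
        * riemannZeta (1 / 2 + ((T + x + u : ℝ) : ℂ) * Complex.I))‖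
        ≤ Real.exp (-u ^ 2 / V ^ 2) * (840 / q ^ 3) := by
      intro u hu
      have hv : |u + x| ≤ q ^ 5 :=
        (abs_add_le u x).trans (by linarith [abs_le.2 ⟨hu.1.le, hu.2⟩])
      have h := hZ (u + x) hv
      have hph : rotatedGauss T V u * Complex.exp (Complex.I *
          ((thetaMain T + (u + x) * ℓ + (u + x) ^ 2 / (4 * T) : ℝ) : ℂ)) =
          κ * ((Real.exp (-u ^ 2 / V ^ 2) : ℂ)
            * Complex.exp (Complex.I * ((x / (2 * T) * u : ℝ) : ℂ))) := by
        rw [rotatedGauss, hℓ, mul_assoc, mul_left_comm κ, ← Complex.exp_add, hκ, ← Complex.exp_add,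
          ← mul_add, ← mul_add, ← Complex.ofReal_add, ← Complex.ofReal_add]
        congr 4
        field_simp
        ring
      have heq : rotatedGauss T V u * (hardyZ (T + u + x) : ℂ)
          - κ * ((Real.exp (-u ^ 2 / V ^ 2) : ℂ)
            * Complex.exp (Complex.I * ((x / (2 * T) * u : ℝ) : ℂ))
          * riemannZeta (1 / 2 + ((T + x + u : ℝ) : ℂ) * Complex.I))
          = rotatedGauss T V u * ((hardyZ (T + (u + x)) : ℂ) - Complex.exp (Complex.I *
            ((thetaMain T + (u + x) * ℓ + (u + x) ^ 2 / (4 * T) : ℝ) : ℂ))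
            * riemannZeta (1 / 2 + ((T + (u + x) : ℝ) : ℂ) * Complex.I)) := by
        rw [mul_sub, ← mul_assoc (rotatedGauss T V u), hph, ← add_assoc T u x,
          add_right_comm T x u, mul_assoc κ]
      rw [heq, norm_mul, norm_rotatedGauss]
      exact mul_le_mul_of_nonneg_left h (Real.exp_pos _).le
    refine (intervalIntegral.norm_integral_le_of_norm_le (by linarith)
      (Filter.Eventually.of_forall hle) (Continuous.intervalIntegrable (by fun_prop) _ _)).trans ?_
    rw [intervalIntegral.integral_mul_const]
    calc _ ≤ 2 * V * (840 / q ^ 3) :=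
          mul_le_mul_of_nonneg_right (intervalIntegral_gauss_le hV hH0) (by positivity)
      _ = 1680 * (V / q ^ 3) := by ring
  · have := continuous_hardyZ
    have := continuous_rotatedGauss T V
    exact Continuous.intervalIntegrable (by fun_prop) _ _
  · exact Continuous.intervalIntegrable (by fun_prop) _ _

/-- For small `x`, the average of `Z(T + u + x)` against the rotated Gaussian is its main term. -/
theorem norm_integral_rotatedGauss_mul_hardyZ_sub_le_of_abs_le {q V L x : ℝ} (hq : 2 ≤ q)
    (hV : 0 < V) (hVq : V ≤ q ^ 4) (hL : 0 ≤ L) (hLq : L ≤ q / 2)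
    (hVexp : Real.exp (-V ^ 2 / 25) ≤ 1 / q ^ 67) (hLexp : Real.exp (-L ^ 2 / 2) ≤ 1 / q ^ 67)
    (hx : |x| ≤ q ^ 3) :
    ‖(∫ u in (-(V * L))..(V * L), rotatedGauss (q ^ 12) V u * (hardyZ (q ^ 12 + u + x) : ℂ))
      - ((Real.sqrt Real.pi * V : ℝ) : ℂ) * Complex.exp (Complex.I * ((thetaMain (q ^ 12)
        + x * Real.log (Real.sqrt (q ^ 12 / (2 * Real.pi))) : ℝ) : ℂ))‖ ≤ 2000 * V / q ^ 3 := by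
  have hq0 : 0 < q := by linarith
  have hHx : V * L + |x| ≤ q ^ 5 := by
    have h1 : V * L ≤ q ^ 4 * (q / 2) := mul_le_mul hVq hLq hL (by positivity)
    have hq2 : (2 : ℝ) ^ 2 ≤ q ^ 2 := pow_le_pow_left₀ (by norm_num) hq 2
    have h2 : q ^ 4 * (q / 2) = q ^ 5 / 2 := by ring
    have h3 : q ^ 5 = q ^ 3 * q ^ 2 := by ring
    nlinarith [pow_pos hq0 3]
  have hrep := norm_integral_rotatedGauss_mul_hardyZ_sub_zeta_le hq hV (mul_nonneg hV.le hL) hHx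
  have hzeta := norm_intervalIntegral_gauss_mul_zeta_sub_le_of_abs_le hq hV hVq hL hLq hVexp hLexp
    hx
  have hphase := norm_exp_I_mul_sub_exp_I_mul_le (thetaMain (q ^ 12)
    + x * Real.log (Real.sqrt (q ^ 12 / (2 * Real.pi))) + x ^ 2 / (4 * q ^ 12))
    (thetaMain (q ^ 12) + x * Real.log (Real.sqrt (q ^ 12 / (2 * Real.pi))))
  have hsq : |thetaMain (q ^ 12) + x * Real.log (Real.sqrt (q ^ 12 / (2 * Real.pi)))
      + x ^ 2 / (4 * q ^ 12) - (thetaMain (q ^ 12)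
      + x * Real.log (Real.sqrt (q ^ 12 / (2 * Real.pi))))| ≤ 1 / q ^ 3 := by
    rw [add_sub_cancel_left, abs_of_nonneg (by positivity), ← sq_abs,
      div_le_div_iff₀ (by positivity) (by positivity)]
    calc |x| ^ 2 * q ^ 3 ≤ (q ^ 3) ^ 2 * q ^ 3 := by gcongr
      _ = q ^ 9 * 1 := by ring
      _ ≤ q ^ 9 * (4 * q ^ 3) := by
        have := one_le_pow₀ (by linarith : 1 ≤ q) (n := 3)
        gcongr; linarith
      _ = 1 * (4 * q ^ 12) := by ring
  replace hphase := hphase.trans hsq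
  set κ : ℂ := Complex.exp (Complex.I * ((thetaMain (q ^ 12)
    + x * Real.log (Real.sqrt (q ^ 12 / (2 * Real.pi))) + x ^ 2 / (4 * q ^ 12) : ℝ) : ℂ)) with hκ
  have hκn : ‖κ‖ = 1 := by rw [hκ, mul_comm, Complex.norm_exp_ofReal_mul_I]
  set B : ℂ := ((Real.sqrt Real.pi * V : ℝ) : ℂ) with hB
  have hBn : ‖B‖ ≤ 2 * V := by
    rw [hB, Complex.norm_real, Real.norm_of_nonneg (by positivity)]
    exact mul_le_mul_of_nonneg_right sqrt_pi_le_two hV.le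
  set Zint : ℂ := ∫ u in (-(V * L))..(V * L), (Real.exp (-u ^ 2 / V ^ 2) : ℂ)
        * Complex.exp (Complex.I * ((x / (2 * q ^ 12) * u : ℝ) : ℂ))
        * riemannZeta (1 / 2 + ((q ^ 12 + x + u : ℝ) : ℂ) * Complex.I)
  set e : ℂ := Complex.exp (Complex.I * ((thetaMain (q ^ 12)
    + x * Real.log (Real.sqrt (q ^ 12 / (2 * Real.pi))) : ℝ) : ℂ))
  set I₀ : ℂ := ∫ u in (-(V * L))..(V * L), rotatedGauss (q ^ 12) V u
    * (hardyZ (q ^ 12 + u + x) : ℂ)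
  have hfin : I₀ - B * e = (I₀ - κ * Zint) + κ * (Zint - B) + B * (κ - e) := by ring
  rw [hfin]
  have n1 : ‖κ * (Zint - B)‖ ≤ 80 * (V / q ^ 3) := by rw [norm_mul, hκn, one_mul]; exact hzeta
  have n3 : ‖B * (κ - e)‖ ≤ 2 * (V / q ^ 3) := by
    rw [norm_mul]
    calc _ ≤ 2 * V * (1 / q ^ 3) := mul_le_mul hBn hphase (norm_nonneg _) (by linarith)
      _ = 2 * (V / q ^ 3) := by ring
  have t1 := norm_add₃_le (a := I₀ - κ * Zint) (b := κ * (Zint - B)) (c := B * (κ - e))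
  have h2000 : 2000 * V / q ^ 3 = 2000 * (V / q ^ 3) := by ring
  have hV0 : 0 ≤ V / q ^ 3 := by positivity
  rw [h2000]
  linarith

/-- The same estimate for all `x`, with a polynomial weight: for large `x` the weight absorbs the
trivial bound. -/
theorem norm_integral_rotatedGauss_mul_hardyZ_sub_le {q V L : ℝ} (hq : 2 ≤ q)
    (hV : 0 < V) (hVq : V ≤ q ^ 4) (hL : 0 ≤ L) (hLq : L ≤ q / 2)
    (hVexp : Real.exp (-V ^ 2 / 25) ≤ 1 / q ^ 67) (hLexp : Real.exp (-L ^ 2 / 2) ≤ 1 / q ^ 67)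
    (x : ℝ) :
    ‖(∫ u in (-(V * L))..(V * L), rotatedGauss (q ^ 12) V u * (hardyZ (q ^ 12 + u + x) : ℂ))
      - ((Real.sqrt Real.pi * V : ℝ) : ℂ) * Complex.exp (Complex.I * ((thetaMain (q ^ 12)
        + x * Real.log (Real.sqrt (q ^ 12 / (2 * Real.pi))) : ℝ) : ℂ))‖
      ≤ 2000 * V / q ^ 3 * (1 + |x|) ^ 6 := by
  have hq0 : 0 < q := by linarith
  have hx0 := abs_nonneg x
  rcases le_or_gt |x| (q ^ 3) with hx | hx
  · refine (norm_integral_rotatedGauss_mul_hardyZ_sub_le_of_abs_le hq hV hVq hL hLq hVexp hLexp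
      hx).trans ?_
    exact le_mul_of_one_le_right (by positivity) (one_le_pow₀ (by linarith))
  set H := V * L with hH
  have hH0 : 0 ≤ H := by positivity
  have hHq : H ≤ q ^ 5 / 2 := by
    calc V * L ≤ q ^ 4 * (q / 2) := mul_le_mul hVq hLq hL (by positivity)
      _ = q ^ 5 / 2 := by ring
  have h512 : q ^ 5 ≤ q ^ 12 := pow_le_pow_right₀ (by linarith) (by norm_num)
  have hq12 : (2 : ℝ) ^ 12 ≤ q ^ 12 := pow_le_pow_left₀ (by norm_num) hq 12
  have h1 : ‖∫ u in (-H)..H, rotatedGauss (q ^ 12) V u * (hardyZ (q ^ 12 + u + x) : ℂ)‖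
      ≤ 2 * V * (9 * q ^ 12 * (1 + |x|)) := by
    have hle : ∀ u ∈ Set.Ioc (-H) H,
        ‖rotatedGauss (q ^ 12) V u * (hardyZ (q ^ 12 + u + x) : ℂ)‖ ≤
        Real.exp (-u ^ 2 / V ^ 2) * (9 * q ^ 12 * (1 + |x|)) := by
      intro u hu
      rw [norm_mul, norm_rotatedGauss, Complex.norm_real, Real.norm_eq_abs]
      refine mul_le_mul_of_nonneg_left ((abs_hardyZ_le _).trans ?_) (Real.exp_pos _).le
      have hu' : |u| ≤ H := abs_le.2 ⟨hu.1.le, hu.2⟩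
      have := abs_add_three (q ^ 12) u x
      rw [abs_of_pos (by positivity : 0 < q ^ 12)] at this
      nlinarith
    refine (intervalIntegral.norm_integral_le_of_norm_le (by linarith)
      (Filter.Eventually.of_forall hle) (Continuous.intervalIntegrable (by fun_prop) _ _)).trans ?_
    rw [intervalIntegral.integral_mul_const]
    exact mul_le_mul_of_nonneg_right (intervalIntegral_gauss_le hV hH0) (by positivity)
  refine (norm_sub_le _ _).trans ?_
  have h2 : ‖((Real.sqrt Real.pi * V : ℝ) : ℂ) * Complex.exp (Complex.I * ((thetaMain (q ^ 12)
        + x * Real.log (Real.sqrt (q ^ 12 / (2 * Real.pi))) : ℝ) : ℂ))‖ ≤ 2 * V := by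
    rw [norm_mul, mul_comm Complex.I, Complex.norm_exp_ofReal_mul_I, mul_one, Complex.norm_real,
      Real.norm_of_nonneg (by positivity)]
    exact mul_le_mul_of_nonneg_right sqrt_pi_le_two hV.le
  -- `|x| > q ^ 3` pays for `T` and for the saving `q ^ (-3)` with five powers of `1 + |x|`
  have h3 : q ^ 12 ≤ 1 / q ^ 3 * (1 + |x|) ^ 5 := by
    rw [one_div, inv_mul_eq_div, le_div_iff₀ (by positivity)]
    calc q ^ 12 * q ^ 3 = (q ^ 3) ^ 5 := by ring
      _ ≤ (1 + |x|) ^ 5 := by gcongr; linarith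
  calc _ ≤ 2 * V * (9 * q ^ 12 * (1 + |x|)) + 2 * V := add_le_add h1 h2
    _ ≤ 20 * V * (q ^ 12 * (1 + |x|)) := by
      have : 1 ≤ q ^ 12 * (1 + |x|) := by nlinarith
      nlinarith
    _ ≤ 20 * V * ((1 / q ^ 3 * (1 + |x|) ^ 5) * (1 + |x|)) := by gcongr
    _ = 20 * V / q ^ 3 * (1 + |x|) ^ 6 := by ring
    _ ≤ 2000 * V / q ^ 3 * (1 + |x|) ^ 6 := by gcongr; norm_num

/-! ### The convolution and the lower bound -/

/-- Only the bounds with `q = 0` and `k = 0, 8` of the Gel'fand–Shilov class are needed: the weight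
`(1 + |u|) ^ 6` is the one of `norm_integral_rotatedGauss_mul_hardyZ_sub_le`, and two more powers
make the product integrable. -/
theorem GelfandShilov.exists_abs_mul_le {α β : ℝ} {f : ℝ → ℝ} (hf : GelfandShilov α β f) :
    ∃ D : ℝ, ∀ u, |f u| * (1 + |u|) ^ 6 ≤ D * (1 + u ^ 2)⁻¹ := by
  obtain ⟨A, hA, B, hB, C, hC, h⟩ := hf.bound
  obtain ⟨D₀, h0⟩ : ∃ D₀, ∀ u, |f u| ≤ D₀ := ⟨_, fun u => by simpa using h 0 0 u⟩
  obtain ⟨D₈, h8⟩ : ∃ D₈, ∀ u, |u| ^ 8 * |f u| ≤ D₈ := ⟨_, fun u => by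
    have := h 8 0 u
    rwa [iteratedDeriv_zero, abs_mul, abs_pow] at this⟩
  refine ⟨2 ^ 7 * (D₀ + D₈), fun u => ?_⟩
  rw [← div_eq_mul_inv, le_div_iff₀ (by positivity)]
  have h1 := add_pow_le (zero_le_one' ℝ) (abs_nonneg u) 8
  have h2 : 1 + u ^ 2 ≤ (1 + |u|) ^ 2 := by nlinarith [sq_abs u, abs_nonneg u]
  calc |f u| * (1 + |u|) ^ 6 * (1 + u ^ 2) ≤ |f u| * (1 + |u|) ^ 6 * (1 + |u|) ^ 2 := by gcongr
    _ = |f u| * (1 + |u|) ^ 8 := by ring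
    _ ≤ |f u| * (2 ^ 7 * (1 ^ 8 + |u| ^ 8)) := mul_le_mul_of_nonneg_left h1 (abs_nonneg _)
    _ = 2 ^ 7 * (|f u| + |u| ^ 8 * |f u|) := by ring
    _ ≤ 2 ^ 7 * (D₀ + D₈) := by gcongr; exacts [h0 u, h8 u]

theorem GelfandShilov.integrable_abs_mul {α β : ℝ} {f : ℝ → ℝ} (hf : GelfandShilov α β f) :
    Integrable fun u => |f u| * (1 + |u|) ^ 6 := by
  obtain ⟨D, hD⟩ := hf.exists_abs_mul_le
  have hc : Continuous f := hf.smooth.continuous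
  refine (integrable_inv_one_add_sq.const_mul D).mono' (by fun_prop)
    (Filter.Eventually.of_forall fun u => ?_)
  rw [Real.norm_of_nonneg (by positivity)]
  exact hD u

theorem integrable_abs_comp_div_mul {f : ℝ → ℝ} (hc : Continuous f)
    (hf : Integrable fun u => |f u| * (1 + |u|) ^ 6) {G : ℝ} (hG : 0 < G) (hG1 : G < 1) :
    Integrable (fun x => |f (x / G)| * (1 + |x|) ^ 6) ∧
      ∫ x, |f (x / G)| * (1 + |x|) ^ 6 ≤ G * ∫ u, |f u| * (1 + |u|) ^ 6 := by
  have hle : ∀ x, |f (x / G)| * (1 + |x|) ^ 6 ≤ |f (x / G)| * (1 + |x / G|) ^ 6 := by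
    intro x
    have : |x| ≤ |x / G| := by
      rw [abs_div, abs_of_pos hG, le_div_iff₀ hG]
      exact mul_le_of_le_one_right (abs_nonneg x) hG1.le
    gcongr
  have hi : Integrable fun x => |f (x / G)| * (1 + |x / G|) ^ 6 := hf.comp_div hG.ne'
  have hi2 : Integrable (fun x => |f (x / G)| * (1 + |x|) ^ 6) := by
    refine hi.mono' (by fun_prop) (Filter.Eventually.of_forall fun x => ?_)
    rw [Real.norm_of_nonneg (by positivity)]
    exact hle x
  refine ⟨hi2, (integral_mono hi2 hi hle).trans (le_of_eq ?_)⟩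
  rw [Measure.integral_comp_div (fun u => |f u| * (1 + |u|) ^ 6) G, abs_of_pos hG, smul_eq_mul]

theorem abs_hardyZ_add_mul_le {f : ℝ → ℝ} {G t R : ℝ} (ht : |t| ≤ R) (x : ℝ) :
    |hardyZ (t + x) * f (x / G)| ≤ (9 + 4 * R) * (|f (x / G)| * (1 + |x|) ^ 6) := by
  have hx := abs_nonneg x
  have hR : 0 ≤ R := (abs_nonneg t).trans ht
  rw [abs_mul]
  have h1 := abs_hardyZ_le (t + x)
  have h2 := abs_add_le t x
  have h3 : (1 + |x|) ≤ (1 + |x|) ^ 6 := le_self_pow₀ (by linarith) (by norm_num)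
  have h4 : |hardyZ (t + x)| ≤ (9 + 4 * R) * (1 + |x|) ^ 6 := by
    have h5 : (9 + 4 * R) * (1 + |x|) ≤ (9 + 4 * R) * (1 + |x|) ^ 6 :=
      mul_le_mul_of_nonneg_left h3 (by linarith)
    nlinarith [mul_nonneg hR hx]
  calc _ ≤ (9 + 4 * R) * (1 + |x|) ^ 6 * |f (x / G)| :=
        mul_le_mul_of_nonneg_right h4 (abs_nonneg _)
    _ = _ := by ring

theorem continuous_convM {f : ℝ → ℝ} (hc : Continuous f) {G : ℝ}
    (hf : Integrable fun x => |f (x / G)| * (1 + |x|) ^ 6) : Continuous (convM f G) := by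
  have hZ := continuous_hardyZ
  rw [continuous_iff_continuousAt]
  intro t₀
  refine continuousAt_of_dominated
    (bound := fun x => (9 + 4 * (|t₀| + 1)) * (|f (x / G)| * (1 + |x|) ^ 6))
    (Filter.Eventually.of_forall fun t => by fun_prop) ?_ (hf.const_mul _)
    (Filter.Eventually.of_forall fun x => by fun_prop)
  filter_upwards [Metric.ball_mem_nhds t₀ one_pos] with t ht
  refine Filter.Eventually.of_forall fun x => abs_hardyZ_add_mul_le ?_ x
  have h1 : |t - t₀| < 1 := by rwa [Metric.mem_ball, Real.dist_eq] at ht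
  have h2 := abs_add_le t₀ (t - t₀)
  rw [add_sub_cancel] at h2
  linarith

/-- Rotating the Gaussian does not increase the integral, and Fubini moves the convolution with
`f (x / G)` outside. -/
theorem norm_integral_le_integral_abs_convM {f : ℝ → ℝ} (hc : Continuous f) {G : ℝ}
    (hf : Integrable fun x => |f (x / G)| * (1 + |x|) ^ 6) (T V : ℝ) {H : ℝ} (hH : 0 ≤ H) :
    ‖∫ x, (f (x / G) : ℂ) * ∫ u in (-H)..H, rotatedGauss T V u * (hardyZ (T + u + x) : ℂ)‖ ≤
      ∫ t in (T - H)..(T + H), |convM f G t| * Real.exp (-(T - t) ^ 2 / V ^ 2) := by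
  have hZ := continuous_hardyZ
  have hW := continuous_rotatedGauss T V
  have hM := continuous_convM hc hf
  have hfub : ∫ x, (f (x / G) : ℂ) * ∫ u in (-H)..H, rotatedGauss T V u * (hardyZ (T + u + x) : ℂ)
      = ∫ u in (-H)..H, rotatedGauss T V u * (convM f G (T + u) : ℂ) := by
    have h1 : ∀ u, rotatedGauss T V u * (convM f G (T + u) : ℂ) = ∫ x,
        (f (x / G) : ℂ) * (rotatedGauss T V u * (hardyZ (T + u + x) : ℂ)) := by
      intro u
      rw [convM, ← integral_complex_ofReal, ← integral_const_mul]
      refine integral_congr_ae (Filter.Eventually.of_forall fun x => ?_)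
      simp only
      push_cast
      ring
    simp_rw [h1, ← intervalIntegral.integral_const_mul]
    rw [intervalIntegral_integral_swap]
    have hfin : IsFiniteMeasure (volume.restrict (Set.uIoc (-H) H)) := by
      rw [Set.uIoc_of_le (by linarith)]
      infer_instance
    have hb : Integrable (fun p : ℝ × ℝ => (9 + 4 * (|T| + H)) *
        (|f (p.2 / G)| * (1 + |p.2|) ^ 6)) ((volume.restrict (Set.uIoc (-H) H)).prod volume) :=
      (hf.comp_snd _).const_mul _
    refine hb.mono' ?_ ?_
    · have : Continuous (Function.uncurry fun (u x : ℝ) =>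
          (f (x / G) : ℂ) * (rotatedGauss T V u * (hardyZ (T + u + x) : ℂ))) := by
        unfold Function.uncurry
        fun_prop
      exact this.aestronglyMeasurable
    · have hmem : ∀ᵐ p : ℝ × ℝ ∂((volume.restrict (Set.uIoc (-H) H)).prod volume),
          p.1 ∈ Set.uIoc (-H) H :=
        Measure.quasiMeasurePreserving_fst.ae (ae_restrict_mem measurableSet_uIoc)
      filter_upwards [hmem] with p hp
      rw [Set.uIoc_of_le (by linarith)] at hp
      have hTu : |T + p.1| ≤ |T| + H :=
        (abs_add_le _ _).trans (by linarith [abs_le.2 ⟨hp.1.le, hp.2⟩])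
      have hle := abs_hardyZ_add_mul_le (f := f) (G := G) hTu p.2
      have hW1 : ‖rotatedGauss T V p.1‖ ≤ 1 := by
        rw [norm_rotatedGauss, Real.exp_le_one_iff]
        exact div_nonpos_of_nonpos_of_nonneg (by nlinarith) (sq_nonneg V)
      have : ‖Function.uncurry (fun (u x : ℝ) =>
          (f (x / G) : ℂ) * (rotatedGauss T V u * (hardyZ (T + u + x) : ℂ))) p‖ =
          ‖rotatedGauss T V p.1‖ * |hardyZ (T + p.1 + p.2) * f (p.2 / G)| := by
        simp only [Function.uncurry, norm_mul, Complex.norm_real, Real.norm_eq_abs, abs_mul]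
        ring
      rw [this]
      exact (mul_le_of_le_one_left (abs_nonneg _) hW1).trans hle
  rw [hfub]
  have hsub : ∫ t in (T - H)..(T + H), |convM f G t| * Real.exp (-(T - t) ^ 2 / V ^ 2) =
      ∫ u in (-H)..H, Real.exp (-u ^ 2 / V ^ 2) * |convM f G (T + u)| := by
    have := intervalIntegral.integral_comp_add_left (a := -H) (b := H)
      (fun t => |convM f G t| * Real.exp (-(T - t) ^ 2 / V ^ 2)) T
    rw [← sub_eq_add_neg] at this
    rw [← this]
    refine intervalIntegral.integral_congr fun u _ => ?_
    rw [mul_comm, sub_add_cancel_left, neg_sq]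
  rw [hsub]
  refine intervalIntegral.norm_integral_le_of_norm_le (by linarith)
    (Filter.Eventually.of_forall fun u _ => ?_) (Continuous.intervalIntegrable (by fun_prop) _ _)
  rw [norm_mul, norm_rotatedGauss, Complex.norm_real, Real.norm_eq_abs]

theorem integral_comp_div_mul_exp (f : ℝ → ℝ) {G : ℝ} (hG : 0 < G) (ℓ : ℝ) :
    ∫ x, (f (x / G) : ℂ) * Complex.exp (Complex.I * ((x * ℓ : ℝ) : ℂ)) =
      G * fourierHat f (G / (2 * Real.pi) * ℓ) := by
  have h := Measure.integral_comp_div (fun u : ℝ => (f u : ℂ) * Complex.exp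
    (2 * Real.pi * Complex.I * ((G / (2 * Real.pi) * ℓ : ℝ) : ℂ) * u)) G
  rw [abs_of_pos hG, Complex.real_smul] at h
  rw [fourierHat, ← h]
  refine integral_congr_ae (Filter.Eventually.of_forall fun x => ?_)
  simp only
  congr 2
  have h1 : (G : ℂ) ≠ 0 := by exact_mod_cast hG.ne'
  have h2 : (Real.pi : ℂ) ≠ 0 := by exact_mod_cast Real.pi_ne_zero
  push_cast
  field_simp

theorem norm_fourierHat_le {f : ℝ → ℝ} (hf : Integrable fun u => |f u| * (1 + |u|) ^ 6) (x : ℝ) :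
    ‖fourierHat f x‖ ≤ ∫ u, |f u| * (1 + |u|) ^ 6 := by
  refine norm_integral_le_of_norm_le hf (Filter.Eventually.of_forall fun u => ?_)
  have h : (2 * Real.pi * Complex.I * x * u : ℂ) = ((2 * Real.pi * x * u : ℝ) : ℂ) * Complex.I := by
    push_cast; ring
  rw [h, norm_mul, Complex.norm_exp_ofReal_mul_I, mul_one, Complex.norm_real, Real.norm_eq_abs]
  exact le_mul_of_one_le_right (abs_nonneg _) (one_le_pow₀ (by linarith [abs_nonneg u]))

/-- The lower bound at the scale `T = q ^ 12`, once the Gaussian factors are negligible. -/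
theorem lower_bound_integral_abs_convM {f : ℝ → ℝ} (hc : Continuous f)
    (hf : Integrable fun u => |f u| * (1 + |u|) ^ 6) {G : ℝ} (hG : 0 < G) (hG1 : G < 1)
    {q V L : ℝ} (hq : 2 ≤ q) (hV : 0 < V) (hVq : V ≤ q ^ 4) (hL : 0 ≤ L) (hLq : L ≤ q / 2)
    (hVexp : Real.exp (-V ^ 2 / 25) ≤ 1 / q ^ 67) (hLexp : Real.exp (-L ^ 2 / 2) ≤ 1 / q ^ 67) :
    G * V * (‖fourierHat f (G / (2 * Real.pi) * Real.log (Real.sqrt (q ^ 12 / (2 * Real.pi))))‖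
        - 2000 * (∫ u, |f u| * (1 + |u|) ^ 6) / q ^ 3) ≤
      ∫ t in (q ^ 12 - V * L)..(q ^ 12 + V * L),
        |convM f G t| * Real.exp (-(q ^ 12 - t) ^ 2 / V ^ 2) := by
  obtain ⟨hi, hile⟩ := integrable_abs_comp_div_mul hc hf hG hG1
  have hE := norm_integral_rotatedGauss_mul_hardyZ_sub_le hq hV hVq hL hLq hVexp hLexp
  refine le_trans ?_ (norm_integral_le_integral_abs_convM hc hi (q ^ 12) V (mul_nonneg hV.le hL))
  have hq0 : 0 < q := by linarith
  have hZ := continuous_hardyZ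
  have hW := continuous_rotatedGauss (q ^ 12) V
  generalize q ^ 12 = T at *
  generalize Real.log (Real.sqrt (T / (2 * Real.pi))) = ℓ at *
  set F : ℝ := ∫ u, |f u| * (1 + |u|) ^ 6
  set I₀ : ℝ → ℂ := fun x =>
    ∫ u in (-(V * L))..(V * L), rotatedGauss T V u * (hardyZ (T + u + x) : ℂ) with hI₀
  set m : ℝ → ℂ := fun x => ((Real.sqrt Real.pi * V : ℝ) : ℂ)
    * Complex.exp (Complex.I * ((thetaMain T + x * ℓ : ℝ) : ℂ)) with hm
  have hIc : Continuous I₀ := by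
    refine intervalIntegral.continuous_parametric_intervalIntegral_of_continuous' ?_ _ _
    unfold Function.uncurry
    fun_prop
  have hmc : Continuous m := by rw [hm]; fun_prop
  have hEb : ∀ x, ‖(f (x / G) : ℂ) * (I₀ x - m x)‖ ≤
      2000 * V / q ^ 3 * (|f (x / G)| * (1 + |x|) ^ 6) := by
    intro x
    rw [norm_mul, Complex.norm_real, Real.norm_eq_abs]
    calc _ ≤ |f (x / G)| * (2000 * V / q ^ 3 * (1 + |x|) ^ 6) :=
          mul_le_mul_of_nonneg_left (hE x) (abs_nonneg _)
      _ = _ := by ring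
  have hEi : Integrable fun x => (f (x / G) : ℂ) * (I₀ x - m x) :=
    (hi.const_mul (2000 * V / q ^ 3)).mono'
      (Continuous.aestronglyMeasurable (by fun_prop)) (Filter.Eventually.of_forall hEb)
  have hmi : Integrable fun x => (f (x / G) : ℂ) * m x := by
    refine (hi.const_mul (Real.sqrt Real.pi * V)).mono'
      (Continuous.aestronglyMeasurable (by fun_prop)) (Filter.Eventually.of_forall fun x => ?_)
    rw [hm]
    simp only
    rw [norm_mul, norm_mul, mul_comm Complex.I, Complex.norm_exp_ofReal_mul_I, mul_one,
      Complex.norm_real, Complex.norm_real, Real.norm_of_nonneg (by positivity : 0 ≤ √Real.pi * V),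
      Real.norm_eq_abs, mul_comm]
    refine mul_le_mul_of_nonneg_left ?_ (by positivity)
    exact le_mul_of_one_le_right (abs_nonneg _) (one_le_pow₀ (by linarith [abs_nonneg x]))
  have hsplit : ∫ x, (f (x / G) : ℂ) * I₀ x =
      (∫ x, (f (x / G) : ℂ) * m x) + ∫ x, (f (x / G) : ℂ) * (I₀ x - m x) := by
    rw [← integral_add hmi hEi]
    refine integral_congr_ae (Filter.Eventually.of_forall fun x => ?_)
    simp only
    ring
  have hmain : ∫ x, (f (x / G) : ℂ) * m x = ((Real.sqrt Real.pi * V : ℝ) : ℂ)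
      * Complex.exp (Complex.I * (thetaMain T : ℝ))
      * (G * fourierHat f (G / (2 * Real.pi) * ℓ)) := by
    rw [← integral_comp_div_mul_exp f hG, ← integral_const_mul]
    refine integral_congr_ae (Filter.Eventually.of_forall fun x => ?_)
    simp only [hm]
    rw [Complex.ofReal_add, mul_add, Complex.exp_add]
    ring
  have hmn : ‖∫ x, (f (x / G) : ℂ) * m x‖ =
      Real.sqrt Real.pi * V * (G * ‖fourierHat f (G / (2 * Real.pi) * ℓ)‖) := by
    rw [hmain, norm_mul, norm_mul, norm_mul, mul_comm Complex.I, Complex.norm_exp_ofReal_mul_I,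
      Complex.norm_real, Complex.norm_real, Real.norm_of_nonneg (by positivity : 0 ≤ √Real.pi * V),
      Real.norm_of_nonneg hG.le, mul_one]
  have hEn : ‖∫ x, (f (x / G) : ℂ) * (I₀ x - m x)‖ ≤ 2000 * V / q ^ 3 * (G * F) := by
    refine (norm_integral_le_of_norm_le (hi.const_mul (2000 * V / q ^ 3))
      (Filter.Eventually.of_forall hEb)).trans ?_
    rw [integral_const_mul]
    exact mul_le_mul_of_nonneg_left hile (by positivity)
  have hpi : 1 ≤ Real.sqrt Real.pi := Real.one_le_sqrt.2 (by linarith [Real.pi_gt_three])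
  have hlow : V * (G * ‖fourierHat f (G / (2 * Real.pi) * ℓ)‖) ≤
      ‖∫ x, (f (x / G) : ℂ) * m x‖ := by
    rw [hmn, mul_assoc]
    exact le_mul_of_one_le_left (by positivity) hpi
  rw [hsplit]
  have htri := norm_sub_le_norm_add (∫ x, (f (x / G) : ℂ) * m x)
    (∫ x, (f (x / G) : ℂ) * (I₀ x - m x))
  have hring : G * V * (‖fourierHat f (G / (2 * Real.pi) * ℓ)‖ - 2000 * F / q ^ 3) =
      V * (G * ‖fourierHat f (G / (2 * Real.pi) * ℓ)‖) - 2000 * V / q ^ 3 * (G * F) := by ring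
  rw [hring]
  linarith

/-- The hypotheses of `lower_bound_integral_abs_convM` hold for large `T`. The exponent
`1 + 2ε > 1` of `log T` in `L ^ 2` is what makes the Gaussian factors smaller than any power
of `T`. -/
theorem exists_large_parameters {ε c : ℝ} (hε : 0 < ε) (hc : 0 < c) : ∃ T₀ : ℝ, 1 < T₀ ∧
    ∀ T L V : ℝ, T₀ ≤ T → L = Real.log T ^ (1 / 2 + ε) → c * L ≤ V →
      2 ≤ T ^ (1 / 12 : ℝ) ∧ L ≤ T ^ (1 / 12 : ℝ) / 2 ∧
      Real.exp (-V ^ 2 / 25) ≤ 1 / (T ^ (1 / 12 : ℝ)) ^ 67 ∧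
      Real.exp (-L ^ 2 / 2) ≤ 1 / (T ^ (1 / 12 : ℝ)) ^ 67 := by
  have h1 : ∀ᶠ T : ℝ in Filter.atTop, 2 ≤ T ^ (1 / 12 : ℝ) :=
    (tendsto_rpow_atTop (by norm_num)).eventually_ge_atTop 2
  have h2 : ∀ᶠ T : ℝ in Filter.atTop,
      ‖Real.log T ^ (1 / 2 + ε)‖ ≤ 1 / 2 * ‖T ^ (1 / 12 : ℝ)‖ :=
    (isLittleO_log_rpow_rpow_atTop (1 / 2 + ε) (by norm_num : (0 : ℝ) < 1 / 12)).bound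
      (by norm_num)
  have h3 : ∀ᶠ T : ℝ in Filter.atTop, 150 / c ^ 2 + 12 ≤ Real.log T ^ (2 * ε) :=
    ((tendsto_rpow_atTop (by positivity)).comp Real.tendsto_log_atTop).eventually_ge_atTop _
  obtain ⟨T₁, hT₁⟩ := Filter.eventually_atTop.1 (h1.and (h2.and h3))
  refine ⟨max T₁ 2, lt_of_lt_of_le one_lt_two (le_max_right _ _), fun T L V hT hL hV => ?_⟩
  obtain ⟨a1, a2, a3⟩ := hT₁ T ((le_max_left _ _).trans hT)
  have hT2 : 2 ≤ T := (le_max_right _ _).trans hT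
  have hlog : 0 < Real.log T := Real.log_pos (by linarith)
  have hL0 : 0 < L := by rw [hL]; positivity
  have hL2 : L ^ 2 = Real.log T * Real.log T ^ (2 * ε) := by
    rw [hL, ← Real.rpow_natCast, ← Real.rpow_mul hlog.le, mul_comm (Real.log T),
      ← Real.rpow_add_one hlog.ne']
    congr 1
    push_cast; ring
  have hq : (T ^ (1 / 12 : ℝ)) ^ 67 = Real.exp (67 / 12 * Real.log T) := by
    rw [← Real.rpow_natCast, ← Real.rpow_mul (by linarith), Real.rpow_def_of_pos (by linarith)]
    congr 1
    push_cast; ring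
  have hneg : 1 / (T ^ (1 / 12 : ℝ)) ^ 67 = Real.exp (-(67 / 12 * Real.log T)) := by
    rw [hq, Real.exp_neg, one_div]
  have hc2 : 0 < 150 / c ^ 2 := by positivity
  refine ⟨a1, ?_, ?_, ?_⟩
  · rw [← hL, Real.norm_of_nonneg hL0.le, Real.norm_of_nonneg (by positivity)] at a2
    linarith
  · rw [hneg]
    refine Real.exp_le_exp.2 ?_
    have hV2 : (c * L) ^ 2 ≤ V ^ 2 := pow_le_pow_left₀ (by positivity) hV 2
    have h4 : 150 * Real.log T ≤ (c * L) ^ 2 := by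
      calc 150 * Real.log T = c ^ 2 * (Real.log T * (150 / c ^ 2)) := by field_simp
        _ ≤ c ^ 2 * (Real.log T * Real.log T ^ (2 * ε)) := by gcongr; linarith
        _ = (c * L) ^ 2 := by rw [← hL2]; ring
    linarith
  · rw [hneg]
    refine Real.exp_le_exp.2 ?_
    have h4 : Real.log T * 12 ≤ L ^ 2 := by
      rw [hL2]
      gcongr
      linarith
    linarith

end

theorem lemma1 (α β : ℝ) (f : ℝ → ℝ) (hf : EvenGelfandShilov α β f)
    (ε : ℝ) (hε : 0 < ε) (c : ℝ) (hc : 0 < c) :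
    ∃ K : ℝ, 0 < K ∧ ∀ T G V L P : ℝ, 1 < T → 0 < G → G < 1 →
      L = (Real.log T) ^ (1 / 2 + ε) → P = Real.sqrt (T / (2 * Real.pi)) →
      c * L ≤ V → V ≤ T ^ (1 / 3 : ℝ) →
      G * V * (‖fourierHat f (G / (2 * Real.pi) * Real.log P)‖ -
          K * (T ^ (-(1 / 4) : ℝ) + V ^ 2 * T ^ (-(3 / 4) : ℝ) * L ^ 2)) ≤
        ∫ t in (T - V * L)..(T + V * L), |convM f G t| * Real.exp (-(T - t) ^ 2 / V ^ 2) := by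
  have hfi := hf.toGelfandShilov.integrable_abs_mul
  have hfc : Continuous f := hf.smooth.continuous
  obtain ⟨T₀, hT₀, hlarge⟩ := exists_large_parameters hε hc
  set F : ℝ := ∫ u, |f u| * (1 + |u|) ^ 6 with hF
  have hF0 : 0 ≤ F := MeasureTheory.integral_nonneg fun u => by positivity
  have hT₀' : 0 < T₀ ^ (1 / 4 : ℝ) := Real.rpow_pos_of_pos (by linarith) _
  refine ⟨2000 * F + F * T₀ ^ (1 / 4 : ℝ) + 1, by positivity, ?_⟩
  set K : ℝ := 2000 * F + F * T₀ ^ (1 / 4 : ℝ) + 1 with hK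
  intro T G V L P hT hG hG1 hL hP hV hVT
  have hT0 : 0 < T := by linarith
  have hlog : 0 < Real.log T := Real.log_pos hT
  have hL0 : 0 < L := by rw [hL]; positivity
  have hV0 : 0 < V := lt_of_lt_of_le (by positivity) hV
  have hK0 : 0 ≤ K := by positivity
  have hextra : 0 ≤ K * (V ^ 2 * T ^ (-(3 / 4) : ℝ) * L ^ 2) := by positivity
  have hT4 : 0 < T ^ (-(1 / 4) : ℝ) := by positivity
  rcases le_or_gt T₀ T with hTT | hTT
  · obtain ⟨b1, b2, b3, b4⟩ := hlarge T L V hTT hL hV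
    have hpow : ∀ n : ℕ, (T ^ (1 / 12 : ℝ)) ^ n = T ^ ((n : ℝ) / 12) := by
      intro n
      rw [← Real.rpow_natCast, ← Real.rpow_mul hT0.le]
      congr 1; ring
    have hq12 : (T ^ (1 / 12 : ℝ)) ^ 12 = T := by rw [hpow]; norm_num
    have hq4 : (T ^ (1 / 12 : ℝ)) ^ 4 = T ^ (1 / 3 : ℝ) := by rw [hpow]; norm_num
    have hq3 : 1 / (T ^ (1 / 12 : ℝ)) ^ 3 = T ^ (-(1 / 4) : ℝ) := by
      rw [hpow, Real.rpow_neg hT0.le, one_div]; norm_num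
    have h := lower_bound_integral_abs_convM hfc hfi hG hG1 b1 hV0 (by rw [hq4]; exact hVT) hL0.le
      b2 b3 b4
    rw [hq12, ← hP, ← hF, ← mul_one_div (2000 * F), hq3] at h
    refine le_trans (mul_le_mul_of_nonneg_left ?_ (by positivity)) h
    have h1 : 2000 * F * T ^ (-(1 / 4) : ℝ) ≤ K * T ^ (-(1 / 4) : ℝ) := by
      refine mul_le_mul_of_nonneg_right ?_ hT4.le
      have : 0 ≤ F * T₀ ^ (1 / 4 : ℝ) := by positivity
      linarith
    rw [mul_add]
    linarith
  · -- for bounded `T` the left side is not positive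
    have hnonneg : 0 ≤ ∫ t in (T - V * L)..(T + V * L),
        |convM f G t| * Real.exp (-(T - t) ^ 2 / V ^ 2) := by
      have : 0 ≤ V * L := by positivity
      exact intervalIntegral.integral_nonneg (by linarith) fun t _ => by positivity
    refine le_trans (mul_nonpos_of_nonneg_of_nonpos (by positivity) ?_) hnonneg
    have h1 := norm_fourierHat_le hfi (G / (2 * Real.pi) * Real.log P)
    have h2 : F ≤ K * T ^ (-(1 / 4) : ℝ) := by
      have h3 : T ^ (1 / 4 : ℝ) * T ^ (-(1 / 4) : ℝ) = 1 := by
        rw [← Real.rpow_add hT0]; norm_num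
      have h4 : T ^ (1 / 4 : ℝ) ≤ T₀ ^ (1 / 4 : ℝ) :=
        Real.rpow_le_rpow hT0.le hTT.le (by norm_num)
      calc F = F * T ^ (1 / 4 : ℝ) * T ^ (-(1 / 4) : ℝ) := by rw [mul_assoc, h3, mul_one]
        _ ≤ F * T₀ ^ (1 / 4 : ℝ) * T ^ (-(1 / 4) : ℝ) := by gcongr
        _ ≤ K * T ^ (-(1 / 4) : ℝ) := by
          refine mul_le_mul_of_nonneg_right ?_ hT4.le
          linarith
    rw [mul_add]
    linarith
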